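/- Let $Z_1,Z_2,Z_3$ be the left invariant vector fields on $SU(2)$, $(Z_if)(s)=\frac{d}{d\lambda}f(s\,e^{\lambda u_i})|_{\lambda=0}$, generated by $$u_1=\tfrac12\begin{pmatrix}0&i\\ i&0\end{pmatrix},\quad u_2=\tfrac12\begin{pmatrix}0&-1\\1&0\end{pmatrix},\quad u_3=\tfrac12\begin{pmatrix}i&0\\0&-i\end{pmatrix},$$ put $X_\pm=-(Z_2\pm i\,Z_1)$, and let $d\mu$ be the normalized Haar measure on $SU(2)$. For a multi-index $\alpha=(\alpha_1,\alpha_2,\alpha_3)$ let $Z^\alpha=c\,\sqrt{\alpha_1!\,\alpha_2!\,\alpha_3!/|\alpha|!}\;\sum_\sigma\sigma$, where $c>0$ is a fixed constant and $\sigma$ runs over the $|\alpha|!/(\alpha_1!\,\alpha_2!\,\alpha_3!)$ distinct ordered products of $|\alpha|$ operators containing $\alpha_i$ factors $Z_i$ ($i=1,2,3$). Put $D^{q,r,\alpha}=\partial_\tau^q\,\partial_\rho^r\,Z^\alpha$. For $\rho_*>0$ and $t\in[0,1)$ let $$N_t=\{0\le\tau\le t,\ 0\le\rho\le\tfrac{\rho_*}{1+\tau},\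 s\in SU(2)\},\qquad S_0=\{\tau=0,\ 0\le\rho\le\rho_*,\ s\in SU(2)\}.$$ Let $m,p$ be non-negative integers with $p>m+2$. There is a constant $C>0$, depending only on $m$ and $p$, such that the following holds for every $\rho_*>0$. Let $\phi_0,\dots,\phi_4$ be complex-valued functions of $(\tau,\rho,s)$, smooth on $\{|\tau|<1,\ \rho\ge0\}\times SU(2)$ (up to the boundary $\rho=0$), which satisfy there the spin-2 equations in the gauge $\mu\equiv1$, i.e. for $k=0,1,2,3$ $$(1+\tau)\,\partial_\tau\phi_k-\rho\,\partial_\rho\phi_k+X_+\phi_{k+1}+(2-k)\,\phi_k=0,$$ $$(1-\tau)\,\partial_\tau\phi_{k+1}+\rho\,\partial_\rho\phi_{k+1}+X_-\phi_k+(1-k)\,\phi_{k+1}=0.$$ Then for all $t\in[0,1)$ and $k=0,\dots,4$ $$\int_{N_t}\sum_{q+r+|\alpha|\le m}|D^{q,r,\alpha}(\partial_\rho^p\phi_k)|^2\,d\tau\,d\rho\,d\mu\ \le\ C\,\sum_{j=0}^4\int_{S_0}\sum_{q+r+|\alpha|\le m}|D^{q,r,\alpha}(\partial_\rho^p\phi_j)|^2\,d\rho\,d\mu,$$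 where all integrals are finite. In particular the left hand side is bounded uniformly in $t\in[0,1)$, i.e. up to $\tau=1$ (the sets $I^+=\{\tau=1,\rho=0\}$ and $\mathcal J^+=\{\tau=1,\rho>0\}$). -/

import Mathlib

open Set MeasureTheory
open scoped ContDiff

noncomputable section

namespace Spin2

/-- The group `SU(2)`, as a topological subspace of the complex `2 × 2` matrices. -/
abbrev SU2 : Type := Matrix.specialUnitaryGroup (Fin 2) ℂ

instance : IsTopologicalGroup SU2 where
  continuous_inv := by
    refine Continuous.subtype_mk ?_ _
    exact continuous_subtype_val.matrix_conjTranspose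

instance : CompactSpace SU2 := by
  have hclosed : IsClosed {A : Matrix (Fin 2) (Fin 2) ℂ |
      A ∈ Matrix.specialUnitaryGroup (Fin 2) ℂ} := by
    have h : {A : Matrix (Fin 2) (Fin 2) ℂ | A ∈ Matrix.specialUnitaryGroup (Fin 2) ℂ} =
        {A | A * star A = 1} ∩ {A | A.det = 1} := by
      ext A
      simp [Matrix.mem_specialUnitaryGroup_iff, Matrix.mem_unitaryGroup_iff]
    rw [h]
    refine IsClosed.inter (isClosed_eq ?_ continuous_const) (isClosed_eq ?_ continuous_const)
    · exact continuous_id.mul (continuous_id.matrix_conjTranspose)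
    · exact continuous_id.matrix_det
  have hbox : IsCompact (Set.pi univ (fun _ : Fin 2 => Set.pi univ
      (fun _ : Fin 2 => Metric.closedBall (0 : ℂ) 1))) :=
    isCompact_univ_pi fun _ => isCompact_univ_pi fun _ => isCompact_closedBall 0 1
  refine isCompact_iff_compactSpace.mp (hbox.of_isClosed_subset hclosed ?_)
  intro A hA i _ j _
  simpa using entry_norm_bound_of_unitary hA.1 i j

instance : MeasurableSpace SU2 := borel SU2

instance : BorelSpace SU2 := ⟨rfl⟩

/-- The normalized Haar measure on `SU(2)`. -/
def haarSU2 : Measure SU2 := Measure.haarMeasure ⊤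

/-- The basis `u₁, u₂, u₃` of the Lie algebra of `SU(2)` (indexed by `0, 1, 2`), with
`[u_i, u_j] = ε_{ijk} u_k`. -/
def u : Fin 3 → Matrix (Fin 2) (Fin 2) ℂ :=
  ![(1 / 2 : ℂ) • !![0, Complex.I; Complex.I, 0],
    (1 / 2 : ℂ) • !![0, -1; 1, 0],
    (1 / 2 : ℂ) • !![Complex.I, 0; 0, -Complex.I]]

theorem star_u (i : Fin 3) : star (u i) = -u i := by
  fin_cases i <;> ext a b <;> fin_cases a <;> fin_cases b <;>
    simp [u]

theorem adjugate_u (i : Fin 3) :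
    !![0, 1; -1, 0] * (u i).transpose * (!![0, 1; -1, 0] : Matrix (Fin 2) (Fin 2) ℂ)⁻¹ = -u i := by
  have hJ : (!![0, 1; -1, 0] : Matrix (Fin 2) (Fin 2) ℂ)⁻¹ = !![0, -1; 1, 0] := by
    apply Matrix.inv_eq_right_inv
    ext a b
    fin_cases a <;> fin_cases b <;> simp [Matrix.mul_apply, Fin.sum_univ_two]
  rw [hJ]
  fin_cases i <;> ext a b <;> fin_cases a <;> fin_cases b <;>
    simp [u, Matrix.mul_apply, Fin.sum_univ_two, Matrix.vecMul, dotProduct]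

theorem exp_u_mem (i : Fin 3) (l : ℝ) :
    NormedSpace.exp (l • u i) ∈ Matrix.specialUnitaryGroup (Fin 2) ℂ := by
  have hinv : NormedSpace.exp (l • u i) * NormedSpace.exp (-(l • u i)) = 1 := by
    rw [← Matrix.exp_add_of_commute _ _ (Commute.refl (l • u i)).neg_right, add_neg_cancel,
      NormedSpace.exp_zero]
  refine Matrix.mem_specialUnitaryGroup_iff.mpr ⟨?_, ?_⟩
  · rw [Matrix.mem_unitaryGroup_iff, Matrix.star_eq_conjTranspose, ← Matrix.exp_conjTranspose,
      ← Matrix.star_eq_conjTranspose, star_smul, star_u, star_trivial, smul_neg]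
    exact hinv
  · have hJu : IsUnit (!![0, 1; -1, 0] : Matrix (Fin 2) (Fin 2) ℂ) := by
      rw [Matrix.isUnit_iff_isUnit_det]
      simp [Matrix.det_fin_two]
    have h1 := Matrix.exp_conj !![0, 1; -1, 0] (l • u i).transpose hJu
    rw [Matrix.exp_transpose, Matrix.transpose_smul, Matrix.mul_smul, Matrix.smul_mul,
      adjugate_u, smul_neg] at h1
    rw [h1] at hinv
    have hJ : (!![0, 1; -1, 0] : Matrix (Fin 2) (Fin 2) ℂ)⁻¹ = !![0, -1; 1, 0] := by
      apply Matrix.inv_eq_right_inv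
      ext a b
      fin_cases a <;> fin_cases b <;> simp [Matrix.mul_apply, Fin.sum_univ_two]
    have h3 := congrFun (congrFun hinv 0) 0
    rw [hJ] at h3
    simp [Matrix.mul_apply, Fin.sum_univ_two, Matrix.vecMul, dotProduct] at h3
    rw [Matrix.det_fin_two]
    linear_combination h3

/-- The one-parameter subgroup `λ ↦ exp (λ u_i)` of `SU(2)`. -/
def expU (i : Fin 3) (l : ℝ) : SU2 := ⟨NormedSpace.exp (l • u i), exp_u_mem i l⟩

/-- Complex functions of `(τ, ρ, s)`. Only their values at `|τ| < 1`, `0 ≤ ρ`, `s ∈ SU(2)` matter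
below. -/
abbrev Fld : Type := ℝ → ℝ → SU2 → ℂ

/-- `f` is smooth on `{|τ| < 1, ρ ≥ 0} × SU(2)`, including the boundary `ρ = 0`: it is the
restriction of a function of `(τ, ρ, matrix)` that is smooth for the matrices in a neighbourhood of
the embedded submanifold `SU(2)`. -/
def SmoothFld (f : Fld) : Prop :=
  ∃ (U : Set (Fin 2 → Fin 2 → ℂ)) (F : ℝ × ℝ × (Fin 2 → Fin 2 → ℂ) → ℂ),
    IsOpen U ∧ (∀ s : SU2, (fun i j => s.1 i j) ∈ U) ∧
    ContDiffOn ℝ ∞ F (Ioo (-1) 1 ×ˢ Ici 0 ×ˢ U) ∧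
    ∀ τ ∈ Ioo (-1 : ℝ) 1, ∀ ρ ∈ Ici (0 : ℝ), ∀ s : SU2,
      f τ ρ s = F (τ, ρ, fun i j => s.1 i j)

/-- `∂_τ`. -/
def dτ (f : Fld) : Fld := fun τ ρ s => deriv (fun x => f x ρ s) τ

/-- `∂_ρ` on `ρ ≥ 0` (one-sided at `ρ = 0`). -/
def dρ (f : Fld) : Fld := fun τ ρ s => derivWithin (fun x => f τ x s) (Ici 0) ρ

/-- The left invariant vector field `Z_i` generated by `u_i`. -/
def Z (i : Fin 3) (f : Fld) : Fld := fun τ ρ s => deriv (fun l : ℝ => f τ ρ (s * expU i l)) 0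

/-- `X_+ = -(Z₂ + i Z₁)`. -/
def Xplus (f : Fld) : Fld := fun τ ρ s => -(Z 1 f τ ρ s + Complex.I * Z 0 f τ ρ s)

/-- `X_- = -(Z₂ - i Z₁)`. -/
def Xminus (f : Fld) : Fld := fun τ ρ s => -(Z 1 f τ ρ s - Complex.I * Z 0 f τ ρ s)

/-- `φ₀, …, φ₄` form a smooth solution on `{|τ| < 1, ρ ≥ 0} × SU(2)` of the spin-2 equations in the
gauge `μ ≡ 1`. -/
structure IsSpin2Solution (φ : Fin 5 → Fld) : Prop where
  smooth : ∀ k, SmoothFld (φ k)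
  eqA : ∀ k : Fin 4, ∀ τ ∈ Ioo (-1 : ℝ) 1, ∀ ρ ∈ Ici (0 : ℝ), ∀ s : SU2,
    (1 + τ) * dτ (φ k.castSucc) τ ρ s - ρ * dρ (φ k.castSucc) τ ρ s
      + Xplus (φ k.succ) τ ρ s + (2 - (k : ℕ)) * φ k.castSucc τ ρ s = 0
  eqB : ∀ k : Fin 4, ∀ τ ∈ Ioo (-1 : ℝ) 1, ∀ ρ ∈ Ici (0 : ℝ), ∀ s : SU2,
    (1 - τ) * dτ (φ k.succ) τ ρ s + ρ * dρ (φ k.succ) τ ρ s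
      + Xminus (φ k.castSucc) τ ρ s + (1 - (k : ℕ)) * φ k.succ τ ρ s = 0

/-- The product `Z_{i₁} ⋯ Z_{i_n}` for a word `i₁ … i_n`. -/
def Zword (w : List (Fin 3)) (f : Fld) : Fld := w.foldr Z f

/-- The words of length `|α|` in which each letter `i` occurs exactly `α i` times. -/
def words (α : Fin 3 → ℕ) : Finset (Fin (∑ i, α i) → Fin 3) :=
  {w | ∀ i, (Finset.univ.filter fun j => w j = i).card = α i}

/-- The operator `Z^α = c √(α! / |α|!) ∑ σ`, the sum running over all distinct products `σ` of
`α i` factors `Z_i`, `i = 1, 2, 3`. -/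
def Zα (c : ℝ) (α : Fin 3 → ℕ) (f : Fld) : Fld := fun τ ρ s =>
  ((c * √((∏ i, (α i).factorial : ℕ) / ((∑ i, α i).factorial : ℕ) : ℝ) : ℝ) : ℂ) *
    ∑ w ∈ words α, Zword (List.ofFn w) f τ ρ s

/-- `D^{q,r,α} = ∂_τ^q ∂_ρ^r Z^α`. -/
def D (c : ℝ) (q r : ℕ) (α : Fin 3 → ℕ) (f : Fld) : Fld := dτ^[q] (dρ^[r] (Zα c α f))

/-- The triples `(q, r, α)` with `q + r + |α| ≤ m`. -/
def indices (m : ℕ) : Finset (ℕ × ℕ × (Fin 3 → ℕ)) :=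
  (Finset.range (m + 1) ×ˢ Finset.range (m + 1) ×ˢ
    Fintype.piFinset fun _ => Finset.range (m + 1)).filter
    fun x => x.1 + x.2.1 + ∑ i, x.2.2 i ≤ m

/-- `∑_{q + r + |α| ≤ m} |D^{q,r,α} f|²`. -/
def density (c : ℝ) (m : ℕ) (f : Fld) (τ ρ : ℝ) (s : SU2) : ℝ :=
  ∑ x ∈ indices m, ‖D c x.1 x.2.1 x.2.2 f τ ρ s‖ ^ 2

/-- `N_t = {0 ≤ τ ≤ t, 0 ≤ ρ ≤ ρ_* / (1 + τ)} × SU(2)`. -/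
def N (ρs t : ℝ) : Set (ℝ × ℝ × SU2) :=
  {x | 0 ≤ x.1 ∧ x.1 ≤ t ∧ 0 ≤ x.2.1 ∧ x.2.1 ≤ ρs / (1 + x.1)}

/-- `S_t`, in the coordinates `(ρ, s)` of the slice `τ = t`. -/
def S (ρs t : ℝ) : Set (ℝ × SU2) := {y | 0 ≤ y.1 ∧ y.1 ≤ ρs / (1 + t)}

end Spin2

end

/-!
On `∑ |∂_τ^q ∂_ρ^r Z_w φ|²`, summed over *all* words `w` of a given length, the left invariant
fields act by the Leibniz rule without commutator terms, because the quadratic form is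
invariant under the adjoint representation. Hence a pair of equations
`L f + X_+ g + a f = 0`, `M g + X_- f + b g = 0` with `L = (1 + τ) ∂_τ - ρ ∂_ρ` and
`M = (1 - τ) ∂_τ + ρ ∂_ρ` gives `L |f|² + M |g|² = -2a |f|² - 2b |g|²` up to terms which are
`X_±`-derivatives and integrate to zero over `SU(2)`. Applying `∂_τ` (`∂_ρ`) to the pair shifts
`(a, b)` by `(1, -1)` (by `(-1, 1)`), so that after `p > m + 2` derivatives in `ρ` the coefficient
`b` is still at least `1` for all derivatives of order up to `m`.

In the coordinate `σ = (1 + τ) ρ` the operator `L` is `(1 + τ) ∂_τ` and the domain `N_t` is a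
product. The energy `∫ |f|² + (1 - τ)/(1 + τ) |g|²` loses its control of `g` as `τ → 1`, but as
`b > 0` its Grönwall inequality also controls the time integral of `|g|²`, uniformly up to `τ = 1`,
and the flux through `σ = ρ_*` has the good sign.

Sums over all words and sums over the symmetrized products `Z^α` are equivalent: modulo words of
lower length a product of the `Z_i` does not depend on the order of its factors.
-/

noncomputable section

namespace Spin2

section Symmetrization

variable {𝕜 B ι : Type*}

/-- The product `x_{i₁} ⋯ x_{i_n}` for a word `i₁ … i_n`. -/
def wordProd [Monoid B] (x : ι → B) (w : List ι) : B := (w.map x).prod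

/-- The sum of the distinct products of the `x i` whose factors are listed by a multiset. -/
def symProd [DecidableEq ι] [Semiring B] (x : ι → B) (s : Multiset ι) : B :=
  ∑ w ∈ s.lists.toFinset, wordProd x w

theorem mem_toFinset_lists [DecidableEq ι] {s : Multiset ι} {w : List ι} :
    w ∈ s.lists.toFinset ↔ (w : Multiset ι) = s := by
  rw [Multiset.mem_toFinset, Multiset.mem_lists_iff, eq_comm]
  rfl

variable [Field 𝕜] [Ring B] [Algebra 𝕜 B] {x : ι → B}

variable (𝕜) in
/-- The span of the products of fewer than `n` of the `x i`. -/
def shorterSpan (x : ι → B) (n : ℕ) : Submodule 𝕜 B :=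
  Submodule.span 𝕜 (wordProd x '' {w | w.length < n})

theorem mul_mem_shorterSpan (i : ι) {n : ℕ} {y : B} (hy : y ∈ shorterSpan 𝕜 x n) :
    x i * y ∈ shorterSpan 𝕜 x (n + 1) := by
  suffices shorterSpan 𝕜 x n ≤ (shorterSpan 𝕜 x (n + 1)).comap (LinearMap.mulLeft 𝕜 (x i)) from
    this hy
  refine Submodule.span_le.2 ?_
  rintro _ ⟨w, hw, rfl⟩
  exact Submodule.subset_span ⟨i :: w, Nat.succ_lt_succ hw, List.prod_cons⟩

theorem wordProd_swap_sub_mem (hx : ∀ i j, ⁅x i, x j⁆ ∈ Submodule.span 𝕜 (range x)) (i j : ι)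
    (w : List ι) :
    wordProd x (i :: j :: w) - wordProd x (j :: i :: w) ∈ shorterSpan 𝕜 x (w.length + 2) := by
  have eq_lie_mul : wordProd x (i :: j :: w) - wordProd x (j :: i :: w) =
      ⁅x i, x j⁆ * wordProd x w := by
    simp only [wordProd, List.map_cons, List.prod_cons, Ring.lie_def]
    noncomm_ring
  suffices Submodule.span 𝕜 (range x) ≤
      (shorterSpan 𝕜 x (w.length + 2)).comap (LinearMap.mulRight 𝕜 (wordProd x w)) from
    eq_lie_mul ▸ this (hx i j)
  refine Submodule.span_le.2 ?_
  rintro _ ⟨k, rfl⟩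
  exact Submodule.subset_span ⟨k :: w, Nat.lt_succ_self _, List.prod_cons⟩

theorem wordProd_sub_mem_of_perm (hx : ∀ i j, ⁅x i, x j⁆ ∈ Submodule.span 𝕜 (range x))
    {w w' : List ι} (h : w.Perm w') :
    wordProd x w - wordProd x w' ∈ shorterSpan 𝕜 x w.length := by
  induction h with
  | nil => simp
  | @cons i w w' _ ih =>
    have := mul_mem_shorterSpan i ih
    rwa [mul_sub] at this
  | swap i j w => exact wordProd_swap_sub_mem hx j i w
  | @trans w₁ w₂ w₃ h₁₂ _ ih₁₂ ih₂₃ =>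
    rw [← h₁₂.length_eq] at ih₂₃
    simpa using add_mem ih₁₂ ih₂₃

variable [DecidableEq ι]

theorem symProd_sub_mem (hx : ∀ i j, ⁅x i, x j⁆ ∈ Submodule.span 𝕜 (range x)) (w : List ι) :
    symProd x w - ((w : Multiset ι).lists.toFinset.card : 𝕜) • wordProd x w ∈
      shorterSpan 𝕜 x w.length := by
  rw [Nat.cast_smul_eq_nsmul, ← Finset.sum_const, symProd, ← Finset.sum_sub_distrib]
  refine sum_mem fun v hv => ?_
  have hvw : v.Perm w := Multiset.coe_eq_coe.1 (mem_toFinset_lists.1 hv)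
  exact hvw.length_eq ▸ wordProd_sub_mem_of_perm hx hvw

theorem wordProd_mem_span_symProd [CharZero 𝕜]
    (hx : ∀ i j, ⁅x i, x j⁆ ∈ Submodule.span 𝕜 (range x)) (w : List ι) :
    wordProd x w ∈ Submodule.span 𝕜 (symProd x '' {s : Multiset ι | s.card ≤ w.length}) := by
  induction hn : w.length using Nat.strong_induction_on generalizing w with
  | _ n ih =>
    subst hn
    have shorter_le : shorterSpan 𝕜 x w.length ≤
        Submodule.span 𝕜 (symProd x '' {s : Multiset ι | s.card ≤ w.length}) := by
      refine Submodule.span_le.2 ?_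
      rintro _ ⟨v, hv, rfl⟩
      have hvw : v.length < w.length := hv
      refine Submodule.span_mono (image_mono ?_) (ih _ hvw v rfl)
      exact fun s hs => le_trans (α := ℕ) hs hvw.le
    have sym_mem : symProd x w ∈
        Submodule.span 𝕜 (symProd x '' {s : Multiset ι | s.card ≤ w.length}) :=
      Submodule.subset_span (mem_image_of_mem _ (Multiset.coe_card w).le)
    have card_ne_zero : ((w : Multiset ι).lists.toFinset.card : 𝕜) ≠ 0 :=
      Nat.cast_ne_zero.2 (Finset.card_pos.2 ⟨w, mem_toFinset_lists.2 rfl⟩).ne'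
    rw [← Submodule.smul_mem_iff _ card_ne_zero]
    exact (Submodule.sub_mem_iff_right _ sym_mem).1 (shorter_le (symProd_sub_mem hx w))

end Symmetrization

section WordForm

variable {R A ι : Type*} [CommRing R] [CommRing A] [Algebra R A]

theorem derivation_sum_apply (t : Finset ι) (D : ι → Derivation R A A) (f : A) :
    (∑ i ∈ t, D i) f = ∑ i ∈ t, D i f :=
  map_sum ((Pi.evalAddMonoidHom _ f).comp Derivation.coeFnAddMonoidHom) D t

/-- The operator `ζ_{i₁} ⋯ ζ_{i_n}` of a word `i₁ … i_n`. -/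
def wordEnd (ζ : ι → Derivation R A A) (w : List ι) : Module.End R A :=
  wordProd (fun i => (ζ i : Module.End R A)) w

variable {ζ : ι → Derivation R A A}

@[simp]
theorem wordEnd_nil : wordEnd ζ [] = 1 := rfl

@[simp]
theorem wordEnd_cons (i : ι) (w : List ι) (f : A) :
    wordEnd ζ (i :: w) f = ζ i (wordEnd ζ w f) := rfl

theorem wordEnd_append (w w' : List ι) (f : A) :
    wordEnd ζ (w ++ w') f = wordEnd ζ w (wordEnd ζ w' f) := by
  rw [wordEnd, wordProd, List.map_append, List.prod_append]
  rfl

theorem commute_wordEnd {D : Derivation R A A} (hD : ∀ i, ⁅D, ζ i⁆ = 0) (w : List ι) :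
    Commute (D : Module.End R A) (wordEnd ζ w) := by
  refine Commute.list_prod_right _ _ fun L hL => ?_
  obtain ⟨i, -, rfl⟩ := List.mem_map.1 hL
  rw [commute_iff_lie_eq, ← Derivation.commutator_coe_linear_map, hD i]
  rfl

variable [Fintype ι]

/-- The bilinear form `∑ ζ_w f · ζ_w g`, the sum running over all the words `w` of length `n`; see
`wordForm_eq_sum`. -/
def wordForm (ζ : ι → Derivation R A A) : ℕ → A →ₗ[R] A →ₗ[R] A
  | 0 => LinearMap.mul R A
  | n + 1 => ∑ i, (wordForm ζ n).compl₁₂ (ζ i : A →ₗ[R] A) (ζ i : A →ₗ[R] A)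

theorem wordForm_succ (n : ℕ) (f g : A) :
    wordForm ζ (n + 1) f g = ∑ i, wordForm ζ n (ζ i f) (ζ i g) := by
  simp [wordForm, LinearMap.sum_apply]

theorem wordForm_eq_sum (n : ℕ) (f g : A) :
    wordForm ζ n f g =
      ∑ w : Fin n → ι, wordEnd ζ (List.ofFn w) f * wordEnd ζ (List.ofFn w) g := by
  induction n generalizing f g with
  | zero => simp [wordForm]
  | succ n ih =>
    rw [← (Fin.snocEquiv fun _ : Fin (n + 1) => ι).sum_comp, Fintype.sum_prod_type, wordForm_succ]
    refine Finset.sum_congr rfl fun j _ => (ih _ _).trans (Finset.sum_congr rfl fun w _ => ?_)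
    simp only [Fin.snocEquiv_apply, List.ofFn_succ', Fin.snoc_castSucc, Fin.snoc_last,
      List.concat_eq_append, wordEnd_append, wordEnd_cons, wordEnd_nil, Module.End.one_apply]

/-- The derivations whose commutators with the `ζ i` are given by a skew-symmetric matrix: those
that act on the span of the `ζ i` by infinitesimal rotations. -/
def skewDerivations (ζ : ι → Derivation R A A) : Submodule R (Derivation R A A) where
  carrier := {D | ∃ c : Matrix ι ι R, c.transpose = -c ∧ ∀ i, ⁅D, ζ i⁆ = ∑ j, c i j • ζ j}
  zero_mem' := ⟨0, by simp, by simp⟩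
  add_mem' := by
    rintro D D' ⟨c, hc, hD⟩ ⟨c', hc', hD'⟩
    refine ⟨c + c', by rw [Matrix.transpose_add, hc, hc', neg_add], fun i => ?_⟩
    simp [hD, hD', add_smul, Finset.sum_add_distrib]
  smul_mem' := by
    rintro r D ⟨c, hc, hD⟩
    refine ⟨r • c, by rw [Matrix.transpose_smul, hc, smul_neg], fun i => ?_⟩
    simp [hD, Finset.smul_sum, smul_smul]

theorem mem_skewDerivations_of_lie_eq_zero {D : Derivation R A A} (hD : ∀ i, ⁅D, ζ i⁆ = 0) :
    D ∈ skewDerivations ζ :=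
  ⟨0, by simp, by simp [hD]⟩

-- The commutator terms of the Leibniz rule cancel in pairs by skew-symmetry.
theorem map_wordForm_of_mem_skewDerivations {D : Derivation R A A} (hD : D ∈ skewDerivations ζ)
    (n : ℕ) (f g : A) :
    D (wordForm ζ n f g) = wordForm ζ n (D f) g + wordForm ζ n f (D g) := by
  obtain ⟨c, hc, hDζ⟩ := hD
  have map_ζ (i : ι) (f : A) : D (ζ i f) = ζ i (D f) + ∑ j, c i j • ζ j f := by
    have := congr($(hDζ i) f)
    rw [Derivation.commutator_apply, sub_eq_iff_eq_add'] at this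
    simpa [derivation_sum_apply] using this
  induction n generalizing f g with
  | zero => simp [wordForm, mul_comm, add_comm]
  | succ n ih =>
    have cancel : ∑ i, ∑ j, c i j • wordForm ζ n (ζ j f) (ζ i g) +
        ∑ i, ∑ j, c i j • wordForm ζ n (ζ i f) (ζ j g) = 0 := by
      rw [Finset.sum_comm, ← Finset.sum_add_distrib]
      refine Finset.sum_eq_zero fun i _ => ?_
      rw [← Finset.sum_add_distrib]
      refine Finset.sum_eq_zero fun j _ => ?_
      have : c j i = -c i j := congr($hc i j)
      rw [this, neg_smul, neg_add_cancel]
    simp only [wordForm_succ, map_sum, ih, map_ζ, map_add, map_smul, LinearMap.add_apply,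
      LinearMap.sum_apply, LinearMap.smul_apply, Finset.sum_add_distrib]
    linear_combination cancel

end WordForm

section Pair

variable {R A : Type*} [CommRing R] [CommRing A] [Algebra R A]

/-- The symmetric hyperbolic pair `L f + X g + a f = 0`, `M g + Y f + b g = 0`. -/
structure IsPair (L M X Y : Derivation R A A) (a b : R) (f g : A) : Prop where
  left : L f + X g + a • f = 0
  right : M g + Y f + b • g = 0

variable {L M X Y D : Derivation R A A} {a b c : R} {f g f' g' : A}

-- The commutators with `D` only shift the zeroth order coefficients.
theorem IsPair.map (h : IsPair L M X Y a b f g) (hL : ⁅D, L⁆ = c • D) (hM : ⁅D, M⁆ = -c • D)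
    (hX : ⁅D, X⁆ = 0) (hY : ⁅D, Y⁆ = 0) : IsPair L M X Y (a + c) (b - c) (D f) (D g) := by
  have comm {E : Derivation R A A} {e : R} (hE : ⁅D, E⁆ = e • D) (x : A) :
      D (E x) = E (D x) + e • D x := by
    have := congr($hE x)
    rwa [Derivation.commutator_apply, sub_eq_iff_eq_add'] at this
  rw [← zero_smul R D] at hX hY
  constructor
  · have := congrArg D h.left
    simp only [map_add, Derivation.map_smul, comm hL, comm hX, map_zero, zero_smul,
      add_zero] at this
    linear_combination this + add_smul a c (D f)
  · have := congrArg D h.right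
    simp only [map_add, Derivation.map_smul, comm hM, comm hY, map_zero, zero_smul,
      add_zero, neg_smul] at this
    linear_combination this + sub_smul b c (D g)

theorem IsPair.iterate (h : IsPair L M X Y a b f g) (hL : ⁅D, L⁆ = c • D) (hM : ⁅D, M⁆ = -c • D)
    (hX : ⁅D, X⁆ = 0) (hY : ⁅D, Y⁆ = 0) (n : ℕ) :
    IsPair L M X Y (a + n * c) (b - n * c) (D^[n] f) (D^[n] g) := by
  induction n with
  | zero => simpa using h
  | succ n ih =>
    rw [Function.iterate_succ_apply', Function.iterate_succ_apply']
    convert ih.map hL hM hX hY using 1 <;> push_cast <;> ring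

theorem IsPair.star [StarRing R] [StarRing A] [StarModule R A] (h : IsPair L M X Y a b f g)
    (hL : ∀ x, L (star x) = star (L x)) (hM : ∀ x, M (star x) = star (M x))
    (hX : ∀ x, X (star x) = star (Y x)) (hY : ∀ x, Y (star x) = star (X x)) :
    IsPair L M Y X (star a) (star b) (star f) (star g) where
  left := by rw [hL, hY, ← star_smul, ← star_add, ← star_add, h.left, star_zero]
  right := by rw [hM, hX, ← star_smul, ← star_add, ← star_add, h.right, star_zero]

theorem IsPair.map_wordForm_add {ι : Type*} [Fintype ι] {ζ : ι → Derivation R A A}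
    (h : IsPair L M X Y a b f g) (h' : IsPair L M Y X a b f' g')
    (hL : L ∈ skewDerivations ζ) (hM : M ∈ skewDerivations ζ)
    (hX : X ∈ skewDerivations ζ) (hY : Y ∈ skewDerivations ζ) (n : ℕ) :
    L (wordForm ζ n f f') + M (wordForm ζ n g g') =
      -(X (wordForm ζ n g f') + Y (wordForm ζ n f g'))
        - ((2 * a) • wordForm ζ n f f' + (2 * b) • wordForm ζ n g g') := by
  have eqs : L f = -(X g + a • f) ∧ M g = -(Y f + b • g) ∧
      L f' = -(Y g' + a • f') ∧ M g' = -(X f' + b • g') := by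
    refine ⟨?_, ?_, ?_, ?_⟩ <;> rw [eq_neg_iff_add_eq_zero, ← add_assoc]
    exacts [h.left, h.right, h'.left, h'.right]
  simp only [map_wordForm_of_mem_skewDerivations hL, map_wordForm_of_mem_skewDerivations hM,
    map_wordForm_of_mem_skewDerivations hX, map_wordForm_of_mem_skewDerivations hY, eqs,
    map_neg, map_add, map_smul, LinearMap.neg_apply, LinearMap.add_apply, LinearMap.smul_apply,
    mul_smul, two_smul]
  ring

end Pair

section Ambient

/-- The real vector space of complex `2 × 2` arrays, in which `SU(2)` is embedded. -/
abbrev Mat : Type := Fin 2 → Fin 2 → ℂ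

/-- The ambient space of the variables `(τ, ρ, matrix)`. -/
abbrev Amb : Type := ℝ × ℝ × Mat

/-- The embedding of `SU(2)` into the arrays. -/
def emb (s : SU2) : Mat := fun i j => s.1 i j

/-- The domain `{|τ| < 1, ρ ≥ 0} × SU(2)`. -/
def dom : Set (ℝ × ℝ × SU2) := Ioo (-1) 1 ×ˢ Ici 0 ×ˢ univ

/-- The embedding of the domain into the ambient space. -/
def toAmb (x : ℝ × ℝ × SU2) : Amb := (x.1, x.2.1, emb x.2.2)

/-- The sets on which smooth extensions to the ambient space are defined. -/
def tube (U : Set Mat) : Set Amb := Ioo (-1) 1 ×ˢ Ici 0 ×ˢ U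

theorem uniqueDiffOn_tube {U : Set Mat} (hU : IsOpen U) : UniqueDiffOn ℝ (tube U) :=
  isOpen_Ioo.uniqueDiffOn.prod ((uniqueDiffOn_Ici 0).prod hU.uniqueDiffOn)

theorem tube_subset_closure_interior {U : Set Mat} (hU : IsOpen U) :
    tube U ⊆ closure (interior (tube U)) := by
  simp only [tube, interior_prod_eq, closure_prod_eq, interior_Ioo, interior_Ici, hU.interior_eq,
    closure_Ioi]
  exact prod_mono subset_closure (prod_mono subset_rfl subset_closure)

theorem continuous_toAmb : Continuous toAmb := by
  have continuous_emb : Continuous emb :=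
    continuous_pi fun i => continuous_pi fun j => continuous_subtype_val.matrix_elem i j
  exact continuous_fst.prodMk ((continuous_fst.comp continuous_snd).prodMk
    (continuous_emb.comp (continuous_snd.comp continuous_snd)))

/-- `F` is a smooth extension of `f` to a neighbourhood of the domain in the ambient space. -/
structure IsExt (U : Set Mat) (F : Amb → ℂ) (f : dom → ℂ) : Prop where
  isOpen : IsOpen U
  emb_mem : ∀ s : SU2, emb s ∈ U
  contDiffOn : ContDiffOn ℝ ∞ F (tube U)
  eq : ∀ x : dom, f x = F (toAmb x)

variable {U V : Set Mat} {F G : Amb → ℂ} {f g : dom → ℂ}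

theorem IsExt.toAmb_mem (h : IsExt U F f) {x : ℝ × ℝ × SU2} (hx : x ∈ dom) : toAmb x ∈ tube U :=
  ⟨hx.1, hx.2.1, h.emb_mem _⟩

theorem IsExt.uniqueDiffWithinAt (h : IsExt U F f) (x : dom) :
    UniqueDiffWithinAt ℝ (tube U) (toAmb x) :=
  uniqueDiffOn_tube h.isOpen _ (h.toAmb_mem x.2)

theorem IsExt.differentiableWithinAt (h : IsExt U F f) (x : dom) :
    DifferentiableWithinAt ℝ F (tube U) (toAmb x) :=
  h.contDiffOn.differentiableOn (by simp) _ (h.toAmb_mem x.2)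

theorem IsExt.inter (h : IsExt U F f) (hV : IsOpen V) (mem : ∀ s : SU2, emb s ∈ V) :
    IsExt (U ∩ V) F f :=
  ⟨h.isOpen.inter hV, fun s => ⟨h.emb_mem s, mem s⟩,
    h.contDiffOn.mono (prod_mono subset_rfl (prod_mono subset_rfl inter_subset_left)), h.eq⟩

theorem IsExt.map₂ (h : IsExt U F f) (k : IsExt U G g) {H : ℂ → ℂ → ℂ}
    (hH : ContDiff ℝ ∞ fun z : ℂ × ℂ => H z.1 z.2) :
    IsExt U (fun y => H (F y) (G y)) (fun x => H (f x) (g x)) :=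
  ⟨h.isOpen, h.emb_mem, hH.comp_contDiffOn (h.contDiffOn.prodMk k.contDiffOn),
    fun x => by rw [h.eq, k.eq]⟩

theorem exists_common_isExt (hf : ∃ U F, IsExt U F f) (hg : ∃ U G, IsExt U G g) :
    ∃ U F G, IsExt U F f ∧ IsExt U G g := by
  obtain ⟨U, F, h⟩ := hf
  obtain ⟨V, G, k⟩ := hg
  exact ⟨U ∩ V, F, G, h.inter k.isOpen k.emb_mem, inter_comm U V ▸ k.inter h.isOpen h.emb_mem⟩

theorem isExt_of_contDiff (hF : ContDiff ℝ ∞ F) : IsExt univ F fun x => F (toAmb x) :=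
  ⟨isOpen_univ, fun _ => mem_univ _, hF.contDiffOn, fun _ => rfl⟩

theorem IsExt.star (h : IsExt U F f) : IsExt U (fun y => star (F y)) (star f) :=
  ⟨h.isOpen, h.emb_mem, Complex.conjCLE.contDiff.comp_contDiffOn h.contDiffOn,
    fun x => by rw [Pi.star_apply, h.eq]⟩

/-- The algebra of the smooth functions on the domain. -/
def smoothAlgebra : StarSubalgebra ℂ (dom → ℂ) where
  carrier := {f | ∃ U F, IsExt U F f}
  mul_mem' hf hg := by
    obtain ⟨U, F, G, h, k⟩ := exists_common_isExt hf hg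
    exact ⟨U, _, h.map₂ k contDiff_mul⟩
  add_mem' hf hg := by
    obtain ⟨U, F, G, h, k⟩ := exists_common_isExt hf hg
    exact ⟨U, _, h.map₂ k contDiff_add⟩
  algebraMap_mem' c := ⟨univ, _, isExt_of_contDiff (contDiff_const (c := c))⟩
  star_mem' := by
    rintro f ⟨U, F, h⟩
    exact ⟨U, _, h.star⟩

/-- The type of the smooth functions on the domain. -/
def SF : Type := smoothAlgebra

instance : CommRing SF := inferInstanceAs (CommRing smoothAlgebra)

instance : Algebra ℂ SF := inferInstanceAs (Algebra ℂ smoothAlgebra)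

instance : StarRing SF := inferInstanceAs (StarRing smoothAlgebra)

instance : StarModule ℂ SF := inferInstanceAs (StarModule ℂ smoothAlgebra)

/-- Evaluation at a point of the domain, as a homomorphism of algebras. -/
def eval (x : dom) : SF →ₐ[ℂ] ℂ :=
  (Pi.evalAlgHom ℂ (fun _ : dom => ℂ) x).comp smoothAlgebra.subtype.toAlgHom

@[ext]
theorem SF.ext {f g : SF} (h : ∀ x, eval x f = eval x g) : f = g :=
  Subtype.ext (funext h)

theorem eval_star (x : dom) (f : SF) : eval x (star f) = star (eval x f) := rfl

theorem IsExt.eval_eq {f : SF} (h : IsExt U F f.1) (x : dom) : eval x f = F (toAmb x) := h.eq x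

/-- A function on the domain as a function of all `(τ, ρ, s)`, extended by zero. -/
def extend (f : SF) : ℝ × ℝ × SU2 → ℂ := Function.extend Subtype.val f.1 0

theorem extend_of_mem (f : SF) {x : ℝ × ℝ × SU2} (hx : x ∈ dom) : extend f x = eval ⟨x, hx⟩ f :=
  Subtype.val_injective.extend_apply f.1 0 ⟨x, hx⟩

theorem extend_of_notMem (f : SF) {x : ℝ × ℝ × SU2} (hx : x ∉ dom) : extend f x = 0 :=
  Function.extend_apply' _ _ _ fun ⟨y, hy⟩ => hx (hy ▸ y.2)

theorem IsExt.extend_eq {f : SF} (h : IsExt U F f.1) {x : ℝ × ℝ × SU2} (hx : x ∈ dom) :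
    extend f x = F (toAmb x) := by
  rw [extend_of_mem f hx, h.eval_eq]

theorem continuousOn_extend (f : SF) : ContinuousOn (extend f) dom := by
  obtain ⟨U, F, h⟩ := f.2
  exact (h.contDiffOn.continuousOn.comp continuous_toAmb.continuousOn
    fun x hx => h.toAmb_mem hx).congr fun x hx => h.extend_eq hx

/-- `γ` maps the parameter set `T` into the domain and has the velocity `v` at `t ∈ T`. -/
structure IsCurve (γ : ℝ → ℝ × ℝ × SU2) (T : Set ℝ) (t : ℝ) (v : Amb) : Prop where
  mem : t ∈ T
  mapsTo : MapsTo γ T dom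
  hasDerivWithinAt : HasDerivWithinAt (fun r => toAmb (γ r)) v T t

theorem IsExt.hasDerivWithinAt {f : SF} (h : IsExt U F f.1) {γ : ℝ → ℝ × ℝ × SU2} {T : Set ℝ}
    {t : ℝ} {v : Amb} (hγ : IsCurve γ T t v) :
    HasDerivWithinAt (fun r => extend f (γ r)) (fderivWithin ℝ F (tube U) (toAmb (γ t)) v) T t :=
  ((h.contDiffOn.differentiableOn (by simp) _
    (h.toAmb_mem (hγ.mapsTo hγ.mem))).hasFDerivWithinAt.comp_hasDerivWithinAt t
      hγ.hasDerivWithinAt fun _ hr => h.toAmb_mem (hγ.mapsTo hr)).congr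
    (fun _ hr => h.extend_eq (hγ.mapsTo hr)) (h.extend_eq (hγ.mapsTo hγ.mem))

end Ambient

section TangentField

/-- A smooth vector field on the ambient space that is tangent to the domain, in the sense that
its values on the domain are velocities of curves in the domain. -/
structure TangentField where
  toFun : Amb → Amb
  contDiff : ContDiff ℝ ∞ toFun
  exists_isCurve : ∀ x ∈ dom, ∃ γ T t,
    γ t = x ∧ UniqueDiffWithinAt ℝ T t ∧ IsCurve γ T t (toFun (toAmb x))

variable {U : Set Mat} {F : Amb → ℂ} {f : dom → ℂ} (V W : TangentField)

/-- The derivative along the vector field `V` of an extension `F` to `tube U`. -/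
def TangentField.along (U : Set Mat) (F : Amb → ℂ) (y : Amb) : ℂ :=
  fderivWithin ℝ F (tube U) y (V.toFun y)

-- Both sides are the derivative of `f` along a curve in the domain.
theorem TangentField.along_eq_of_isExt {f : SF} {U' : Set Mat} {F' : Amb → ℂ}
    (h : IsExt U F f.1) (h' : IsExt U' F' f.1) {x : ℝ × ℝ × SU2} (hx : x ∈ dom) :
    V.along U F (toAmb x) = V.along U' F' (toAmb x) := by
  obtain ⟨γ, T, t, rfl, hT, hγ⟩ := V.exists_isCurve x hx
  exact hT.eq_deriv _ (h.hasDerivWithinAt hγ) (h'.hasDerivWithinAt hγ)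

theorem TangentField.isExt_along (h : IsExt U F f) :
    IsExt U (V.along U F) fun x => V.along U F (toAmb x) :=
  ⟨h.isOpen, h.emb_mem, (h.contDiffOn.fderivWithin (uniqueDiffOn_tube h.isOpen)
    (by simp)).clm_apply V.contDiff.contDiffOn, fun _ => rfl⟩

/-- The derivative of a smooth function along a tangent vector field, computed on an arbitrary
extension. -/
def TangentField.deriv (f : SF) : SF :=
  ⟨fun x => V.along f.2.choose f.2.choose_spec.choose (toAmb x), _, _,
    V.isExt_along f.2.choose_spec.choose_spec⟩

theorem TangentField.isExt_deriv {f : SF} (h : IsExt U F f.1) :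
    IsExt U (V.along U F) (V.deriv f).1 :=
  ⟨h.isOpen, h.emb_mem, (V.isExt_along h).contDiffOn,
    fun x => V.along_eq_of_isExt f.2.choose_spec.choose_spec h x.2⟩

theorem TangentField.eval_deriv {f : SF} (h : IsExt U F f.1) (x : dom) :
    eval x (V.deriv f) = fderivWithin ℝ F (tube U) (toAmb x) (V.toFun (toAmb x)) :=
  (V.isExt_deriv h).eval_eq x

/-- The derivation of the algebra of smooth functions defined by a tangent vector field. -/
def TangentField.derivation : Derivation ℂ SF SF :=
  Derivation.mk'
    { toFun := V.deriv
      map_add' := fun f g => by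
        obtain ⟨U, F, G, hF, hG⟩ := exists_common_isExt f.2 g.2
        ext x
        have hfg : eval x (V.deriv (f + g)) = _ :=
          V.eval_deriv (hF.map₂ hG contDiff_add) x
        rw [hfg, fderivWithin_fun_add (hF.uniqueDiffWithinAt x) (hF.differentiableWithinAt x)
          (hG.differentiableWithinAt x)]
        exact congrArg₂ (· + ·) (V.eval_deriv hF x).symm (V.eval_deriv hG x).symm
      map_smul' := fun c f => by
        obtain ⟨U, F, hF⟩ := f.2
        ext x
        have hcf : eval x (V.deriv (c • f)) = _ :=
          V.eval_deriv (hF.map₂ hF (H := fun z _ => c • z) (contDiff_fst.const_smul c)) x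
        rw [hcf, fderivWithin_fun_const_smul (hF.uniqueDiffWithinAt x)
          (hF.differentiableWithinAt x)]
        exact congrArg (c • ·) (V.eval_deriv hF x).symm }
    fun f g => by
      obtain ⟨U, F, G, hF, hG⟩ := exists_common_isExt f.2 g.2
      ext x
      have hfg : eval x (V.deriv (f * g)) = _ :=
        V.eval_deriv (hF.map₂ hG contDiff_mul) x
      refine hfg.trans ?_
      rw [fderivWithin_fun_mul (hF.uniqueDiffWithinAt x) (hF.differentiableWithinAt x)
        (hG.differentiableWithinAt x)]
      change F (toAmb x) * _ + G (toAmb x) * _ =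
        eval x f * eval x (V.deriv g) + eval x g * eval x (V.deriv f)
      rw [hF.eval_eq, hG.eval_eq, V.eval_deriv hF, V.eval_deriv hG]
      rfl

theorem TangentField.isExt_derivation {f : SF} (h : IsExt U F f.1) :
    IsExt U (V.along U F) (V.derivation f).1 :=
  V.isExt_deriv h

theorem TangentField.derivation_star (f : SF) : V.derivation (star f) = star (V.derivation f) := by
  obtain ⟨U, F, h⟩ := f.2
  ext x
  have hstar : eval x (V.derivation (star f)) = _ := V.eval_deriv h.star x
  have chain := ((Complex.conjCLE : ℂ →L[ℝ] ℂ).hasFDerivAt.comp_hasFDerivWithinAt _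
    (h.differentiableWithinAt x).hasFDerivWithinAt).fderivWithin (h.uniqueDiffWithinAt x)
  exact hstar.trans (congr($chain _).trans (congrArg star (V.eval_deriv h x).symm))

theorem TangentField.eval_lie_derivation {f : SF} (h : IsExt U F f.1) (x : dom) :
    eval x (⁅V.derivation, W.derivation⁆ f) = fderivWithin ℝ F (tube U) (toAmb x)
      (VectorField.lieBracket ℝ V.toFun W.toFun (toAmb x)) := by
  have two_le : minSmoothness ℝ 2 ≤ (∞ : WithTop ℕ∞) := by
    simpa using WithTop.coe_le_coe.2 (le_top : (2 : ℕ∞) ≤ ⊤)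
  have differentiable (X : TangentField) (y : Amb) : DifferentiableAt ℝ X.toFun y :=
    X.contDiff.differentiable (by simp) y
  rw [← VectorField.lieBracketWithin_eq_lieBracket (h.uniqueDiffWithinAt x) (differentiable V _)
    (differentiable W _), VectorField.fderivWithin_apply_lieBracket
    (h.contDiffOn _ (h.toAmb_mem x.2)) two_le (uniqueDiffOn_tube h.isOpen)
    (tube_subset_closure_interior h.isOpen (h.toAmb_mem x.2)) (h.toAmb_mem x.2)
    (differentiable W _).differentiableWithinAt (differentiable V _).differentiableWithinAt]
  exact congrArg₂ (· - ·) (V.eval_deriv (W.isExt_deriv h) x) (W.eval_deriv (V.isExt_deriv h) x)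

theorem TangentField.lie_derivation_eq_sum {ι : Type*} [Fintype ι] {X : ι → TangentField}
    {c : ι → ℝ}
    (h : ∀ y, VectorField.lieBracket ℝ V.toFun W.toFun y = ∑ k, c k • (X k).toFun y) :
    ⁅V.derivation, W.derivation⁆ = ∑ k, (c k : ℂ) • (X k).derivation := by
  ext f x
  obtain ⟨U, F, hF⟩ := f.2
  have eval_field (k : ι) : eval x ((X k).derivation f) = _ := (X k).eval_deriv hF x
  rw [V.eval_lie_derivation W hF, h, map_sum, derivation_sum_apply, map_sum]
  refine Finset.sum_congr rfl fun k _ => ?_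
  rw [map_smul, Derivation.smul_apply, map_smul, eval_field, Complex.coe_smul]

theorem TangentField.lie_derivation_eq_zero
    (h : ∀ y, VectorField.lieBracket ℝ V.toFun W.toFun y = 0) :
    ⁅V.derivation, W.derivation⁆ = 0 := by
  simpa using V.lie_derivation_eq_sum W (ι := Empty) (X := nofun) (c := nofun) (by simpa using h)

/-- The restriction to the domain of a linear function on the ambient space. -/
def linearSF (ℓ : Amb →L[ℝ] ℂ) : SF :=
  ⟨fun x => ℓ (toAmb x), univ, ℓ, isExt_of_contDiff ℓ.contDiff⟩

theorem TangentField.eval_derivation_linearSF (ℓ : Amb →L[ℝ] ℂ) (x : dom) :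
    eval x (V.derivation (linearSF ℓ)) = ℓ (V.toFun (toAmb x)) := by
  have hℓ : IsExt univ ℓ (linearSF ℓ).1 := isExt_of_contDiff ℓ.contDiff
  refine (V.eval_deriv hℓ x).trans ?_
  rw [ℓ.fderivWithin (hℓ.uniqueDiffWithinAt x)]

theorem TangentField.hasDerivWithinAt (f : SF) {γ : ℝ → ℝ × ℝ × SU2} {T : Set ℝ} {t : ℝ}
    (hγ : IsCurve γ T t (V.toFun (toAmb (γ t)))) :
    HasDerivWithinAt (fun r => extend f (γ r)) (extend (V.derivation f) (γ t)) T t := by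
  obtain ⟨U, F, h⟩ := f.2
  rw [(V.isExt_derivation h).extend_eq (hγ.mapsTo hγ.mem)]
  exact h.hasDerivWithinAt hγ

end TangentField

section Generators

/-- Right multiplication of the arrays by a matrix. -/
def mulRightL (B : Matrix (Fin 2) (Fin 2) ℂ) : Mat →L[ℝ] Mat :=
  LinearMap.toContinuousLinearMap
    ((Matrix.ofLinearEquiv ℝ).symm.conj (LinearMap.mulRight ℝ B) : Mat →ₗ[ℝ] Mat)

theorem of_mulRightL (B : Matrix (Fin 2) (Fin 2) ℂ) (A : Mat) :
    Matrix.ofLinearEquiv ℝ (mulRightL B A) = Matrix.ofLinearEquiv ℝ A * B := rfl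

theorem hasDerivAt_emb_mul_expU (i : Fin 3) (s : SU2) (l : ℝ) :
    HasDerivAt (fun l : ℝ => emb (s * expU i l)) (mulRightL (u i) (emb (s * expU i l))) l := by
  let _ : NormedRing (Matrix (Fin 2) (Fin 2) ℂ) := Matrix.linftyOpNormedRing
  let _ : NormedAlgebra ℝ (Matrix (Fin 2) (Fin 2) ℂ) := Matrix.linftyOpNormedAlgebra
  have matrix_deriv : HasDerivAt (fun l : ℝ => s.1 * NormedSpace.exp (l • u i))
      (s.1 * NormedSpace.exp (l • u i) * u i) l := by
    rw [mul_assoc]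
    exact (hasDerivAt_exp_smul_const (u i) l).const_mul s.1
  let toMat : Matrix (Fin 2) (Fin 2) ℂ →L[ℝ] Mat := LinearMap.toContinuousLinearMap
    { toFun := fun A => A, map_add' := fun _ _ => rfl, map_smul' := fun _ _ => rfl }
  exact toMat.hasFDerivAt.comp_hasDerivAt l matrix_deriv

theorem expU_zero (i : Fin 3) : expU i 0 = 1 :=
  Subtype.ext (by simp [expU])

/-- The sign of the permutation `(i, j, k)` of `(0, 1, 2)`, and `0` if two indices agree. -/
def leviCivita (i j k : Fin 3) : ℝ := ((j : ℝ) - i) * (k - i) * (k - j) / 2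

theorem leviCivita_swap (i j k : Fin 3) : leviCivita i k j = -leviCivita i j k := by
  unfold leviCivita
  ring

theorem u_lie (i j : Fin 3) : ⁅u i, u j⁆ = ∑ k, leviCivita i j k • u k := by
  rw [Ring.lie_def, Fin.sum_univ_three]
  fin_cases i <;> fin_cases j <;> ext a b <;> fin_cases a <;> fin_cases b <;>
    simp [u, leviCivita] <;> ring_nf <;> simp <;> ring

end Generators

section Fields

theorem isCurve_τ {x : ℝ × ℝ × SU2} (hx : x ∈ dom) :
    IsCurve (fun r => (r, x.2.1, x.2.2)) (Ioo (-1) 1) x.1 (1, 0, 0) :=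
  ⟨hx.1, fun _ hr => ⟨hr, hx.2⟩,
    (hasDerivWithinAt_id _ _).prodMk (hasDerivWithinAt_const _ _ (x.2.1, emb x.2.2))⟩

theorem isCurve_ρ {x : ℝ × ℝ × SU2} (hx : x ∈ dom) :
    IsCurve (fun r => (x.1, r, x.2.2)) (Ici 0) x.2.1 (0, 1, 0) :=
  ⟨hx.2.1, fun _ hr => ⟨hx.1, hr, mem_univ _⟩, (hasDerivWithinAt_const _ _ _).prodMk
    ((hasDerivWithinAt_id _ _).prodMk (hasDerivWithinAt_const _ _ (emb x.2.2)))⟩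

/-- The vector field `∂_τ`. -/
def fieldτ : TangentField where
  toFun _ := (1, 0, 0)
  contDiff := contDiff_const
  exists_isCurve _ hx := ⟨_, _, _, rfl, isOpen_Ioo.uniqueDiffWithinAt hx.1, isCurve_τ hx⟩

/-- The vector field `∂_ρ`. -/
def fieldρ : TangentField where
  toFun _ := (0, 1, 0)
  contDiff := contDiff_const
  exists_isCurve _ hx := ⟨_, _, _, rfl, uniqueDiffOn_Ici 0 _ hx.2.1, isCurve_ρ hx⟩

/-- The linear vector field on the ambient space that extends the left invariant field `Z i`. -/
def genL (i : Fin 3) : Amb →L[ℝ] Amb :=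
  (ContinuousLinearMap.inr ℝ ℝ (ℝ × Mat)).comp ((ContinuousLinearMap.inr ℝ ℝ Mat).comp
    ((mulRightL (u i)).comp ((ContinuousLinearMap.snd ℝ ℝ Mat).comp
      (ContinuousLinearMap.snd ℝ ℝ (ℝ × Mat)))))

theorem genL_apply (i : Fin 3) (x : Amb) : genL i x = (0, 0, mulRightL (u i) x.2.2) := rfl

/-- The one-parameter orbit of the left invariant field `Z i`. -/
def orbit (i : Fin 3) (x : ℝ × ℝ × SU2) (l : ℝ) : ℝ × ℝ × SU2 := (x.1, x.2.1, x.2.2 * expU i l)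

theorem isCurve_orbit (i : Fin 3) {x : ℝ × ℝ × SU2} (hx : x ∈ dom) (l : ℝ) :
    IsCurve (orbit i x) univ l (genL i (toAmb (orbit i x l))) :=
  ⟨mem_univ _, fun _ _ => ⟨hx.1, hx.2.1, mem_univ _⟩, (hasDerivWithinAt_const _ _ _).prodMk
    ((hasDerivWithinAt_const _ _ _).prodMk (hasDerivAt_emb_mul_expU i _ l).hasDerivWithinAt)⟩

theorem orbit_zero (i : Fin 3) (x : ℝ × ℝ × SU2) : orbit i x 0 = x := by
  rw [orbit, expU_zero, mul_one]

theorem isCurve_orbit_zero (i : Fin 3) {x : ℝ × ℝ × SU2} (hx : x ∈ dom) :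
    IsCurve (orbit i x) univ 0 (genL i (toAmb x)) := by
  simpa only [orbit_zero] using isCurve_orbit i hx 0

/-- The vector field `Z i`. -/
def fieldZ (i : Fin 3) : TangentField where
  toFun := genL i
  contDiff := (genL i).contDiff
  exists_isCurve x hx := ⟨orbit i x, univ, 0, orbit_zero i x, uniqueDiffWithinAt_univ,
    isCurve_orbit_zero i hx⟩

/-- `∂_τ` on the smooth functions. -/
def δτ : Derivation ℂ SF SF := fieldτ.derivation

/-- `∂_ρ` on the smooth functions. -/
def δρ : Derivation ℂ SF SF := fieldρ.derivation

/-- `Z i` on the smooth functions. -/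
def ζ (i : Fin 3) : Derivation ℂ SF SF := (fieldZ i).derivation

theorem lie_δτ_δρ : ⁅δτ, δρ⁆ = 0 :=
  fieldτ.lie_derivation_eq_zero fieldρ fun y => by simp [VectorField.lieBracket, fieldτ, fieldρ]

theorem lie_δτ_ζ (i : Fin 3) : ⁅δτ, ζ i⁆ = 0 :=
  fieldτ.lie_derivation_eq_zero (fieldZ i) fun y => by
    simp [VectorField.lieBracket, fieldτ, fieldZ, genL_apply]

theorem lie_δρ_ζ (i : Fin 3) : ⁅δρ, ζ i⁆ = 0 :=
  fieldρ.lie_derivation_eq_zero (fieldZ i) fun y => by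
    simp [VectorField.lieBracket, fieldρ, fieldZ, genL_apply]

theorem lie_ζ_ζ (i j : Fin 3) : ⁅ζ i, ζ j⁆ = ∑ k, (leviCivita i j k : ℂ) • ζ k := by
  refine (fieldZ i).lie_derivation_eq_sum (fieldZ j) (X := fieldZ) fun y => ?_
  have mul_lie : mulRightL (u j) (mulRightL (u i) y.2.2) - mulRightL (u i) (mulRightL (u j) y.2.2) =
      ∑ k, leviCivita i j k • mulRightL (u k) y.2.2 := by
    apply (Matrix.ofLinearEquiv ℝ).injective
    simp only [map_sub, map_sum, map_smul, of_mulRightL, mul_assoc, ← mul_smul_comm]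
    rw [← mul_sub, ← Finset.mul_sum, ← Ring.lie_def, u_lie]
  have bracket : VectorField.lieBracket ℝ (fieldZ i).toFun (fieldZ j).toFun y =
      genL j (genL i y) - genL i (genL j y) := by
    simp [VectorField.lieBracket, fieldZ]
  rw [bracket]
  refine Prod.ext ?_ (Prod.ext ?_ ?_)
  · simp [genL_apply, fieldZ, Prod.fst_sum]
  · simp [genL_apply, fieldZ, Prod.fst_sum, Prod.snd_sum]
  · simp [genL_apply, fieldZ, Prod.snd_sum, mul_lie]

theorem ζ_mem_skewDerivations (i : Fin 3) : ζ i ∈ skewDerivations ζ :=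
  ⟨Matrix.of fun j k => (leviCivita i j k : ℂ),
    Matrix.ext fun j k => by simp [leviCivita_swap i k j], lie_ζ_ζ i⟩

theorem lie_ζ_mem_span (i j : Fin 3) :
    ⁅(ζ i : Module.End ℂ SF), (ζ j : Module.End ℂ SF)⁆ ∈
      Submodule.span ℂ (range fun k => (ζ k : Module.End ℂ SF)) := by
  have lie_eq : ⁅(ζ i : Module.End ℂ SF), (ζ j : Module.End ℂ SF)⁆ =
      ∑ k, (leviCivita i j k : ℂ) • (ζ k : Module.End ℂ SF) := by
    rw [← Derivation.commutator_coe_linear_map, lie_ζ_ζ]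
    ext1 f
    simp [derivation_sum_apply]
  rw [lie_eq]
  exact sum_mem fun k _ => Submodule.smul_mem _ _ (Submodule.subset_span (mem_range_self k))

/-- The coordinate `τ` as a smooth function. -/
def coordτ : SF := linearSF (Complex.ofRealCLM.comp (ContinuousLinearMap.fst ℝ ℝ (ℝ × Mat)))

/-- The coordinate `ρ` as a smooth function. -/
def coordρ : SF := linearSF (Complex.ofRealCLM.comp
  ((ContinuousLinearMap.fst ℝ ℝ Mat).comp (ContinuousLinearMap.snd ℝ ℝ (ℝ × Mat))))

@[simp]
theorem δτ_coordτ : δτ coordτ = 1 := by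
  ext x
  exact (fieldτ.eval_derivation_linearSF _ x).trans (by simp [fieldτ])

@[simp]
theorem δτ_coordρ : δτ coordρ = 0 := by
  ext x
  exact (fieldτ.eval_derivation_linearSF _ x).trans (by simp [fieldτ])

@[simp]
theorem δρ_coordτ : δρ coordτ = 0 := by
  ext x
  exact (fieldρ.eval_derivation_linearSF _ x).trans (by simp [fieldρ])

@[simp]
theorem δρ_coordρ : δρ coordρ = 1 := by
  ext x
  exact (fieldρ.eval_derivation_linearSF _ x).trans (by simp [fieldρ])

@[simp]
theorem ζ_coordτ (i : Fin 3) : ζ i coordτ = 0 := by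
  ext x
  exact ((fieldZ i).eval_derivation_linearSF _ x).trans (by simp [fieldZ, genL_apply])

@[simp]
theorem ζ_coordρ (i : Fin 3) : ζ i coordρ = 0 := by
  ext x
  exact ((fieldZ i).eval_derivation_linearSF _ x).trans (by simp [fieldZ, genL_apply])

@[simp]
theorem star_coordτ : star coordτ = coordτ := by
  ext x
  exact Complex.conj_ofReal _

@[simp]
theorem star_coordρ : star coordρ = coordρ := by
  ext x
  exact Complex.conj_ofReal _

end Fields

section Operators

/-- `(1 + τ) ∂_τ - ρ ∂_ρ`, the transport operator of the first equation. -/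
def transL : Derivation ℂ SF SF := (1 + coordτ) • δτ - coordρ • δρ

/-- `(1 - τ) ∂_τ + ρ ∂_ρ`, the transport operator of the second equation. -/
def transM : Derivation ℂ SF SF := (1 - coordτ) • δτ + coordρ • δρ

/-- `X_+` on the smooth functions. -/
def χplus : Derivation ℂ SF SF := -(ζ 1 + Complex.I • ζ 0)

/-- `X_-` on the smooth functions. -/
def χminus : Derivation ℂ SF SF := -(ζ 1 - Complex.I • ζ 0)

theorem transL_apply (f : SF) : transL f = (1 + coordτ) * δτ f - coordρ * δρ f := rfl

theorem transM_apply (f : SF) : transM f = (1 - coordτ) * δτ f + coordρ * δρ f := rfl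

theorem δτ_δρ (f : SF) : δτ (δρ f) = δρ (δτ f) :=
  sub_eq_zero.1 ((Derivation.commutator_apply f).symm.trans congr($lie_δτ_δρ f))

theorem δτ_ζ (i : Fin 3) (f : SF) : δτ (ζ i f) = ζ i (δτ f) :=
  sub_eq_zero.1 ((Derivation.commutator_apply f).symm.trans congr($(lie_δτ_ζ i) f))

theorem δρ_ζ (i : Fin 3) (f : SF) : δρ (ζ i f) = ζ i (δρ f) :=
  sub_eq_zero.1 ((Derivation.commutator_apply f).symm.trans congr($(lie_δρ_ζ i) f))

theorem lie_δτ_transL : ⁅δτ, transL⁆ = (1 : ℂ) • δτ := by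
  refine Derivation.ext fun f => ?_
  simp [Derivation.commutator_apply, transL_apply, δτ_δρ]

theorem lie_δτ_transM : ⁅δτ, transM⁆ = (-1 : ℂ) • δτ := by
  refine Derivation.ext fun f => ?_
  simp [Derivation.commutator_apply, transM_apply, δτ_δρ]

theorem lie_δρ_transL : ⁅δρ, transL⁆ = (-1 : ℂ) • δρ := by
  refine Derivation.ext fun f => ?_
  simp [Derivation.commutator_apply, transL_apply, δτ_δρ]

theorem lie_δρ_transM : ⁅δρ, transM⁆ = -(-1 : ℂ) • δρ := by
  refine Derivation.ext fun f => ?_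
  simp [Derivation.commutator_apply, transM_apply, δτ_δρ]

theorem transL_mem_skewDerivations : transL ∈ skewDerivations ζ :=
  mem_skewDerivations_of_lie_eq_zero fun i => Derivation.ext fun f => by
    simp [Derivation.commutator_apply, transL_apply, δτ_ζ, δρ_ζ]

theorem transM_mem_skewDerivations : transM ∈ skewDerivations ζ :=
  mem_skewDerivations_of_lie_eq_zero fun i => Derivation.ext fun f => by
    simp [Derivation.commutator_apply, transM_apply, δτ_ζ, δρ_ζ]

theorem χplus_mem_skewDerivations : χplus ∈ skewDerivations ζ :=
  neg_mem (add_mem (ζ_mem_skewDerivations 1) (Submodule.smul_mem _ _ (ζ_mem_skewDerivations 0)))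

theorem χminus_mem_skewDerivations : χminus ∈ skewDerivations ζ :=
  neg_mem (sub_mem (ζ_mem_skewDerivations 1) (Submodule.smul_mem _ _ (ζ_mem_skewDerivations 0)))

theorem lie_χplus_eq_zero {D : Derivation ℂ SF SF} (hD : ∀ i, ⁅D, ζ i⁆ = 0) : ⁅D, χplus⁆ = 0 := by
  simp [χplus, hD]

theorem lie_χminus_eq_zero {D : Derivation ℂ SF SF} (hD : ∀ i, ⁅D, ζ i⁆ = 0) :
    ⁅D, χminus⁆ = 0 := by
  simp [χminus, hD]

theorem transL_star (f : SF) : transL (star f) = star (transL f) := by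
  simp [transL_apply, fieldτ.derivation_star, fieldρ.derivation_star, δτ, δρ]

theorem transM_star (f : SF) : transM (star f) = star (transM f) := by
  simp [transM_apply, fieldτ.derivation_star, fieldρ.derivation_star, δτ, δρ]

theorem χplus_star (f : SF) : χplus (star f) = star (χminus f) := by
  simp [χplus, χminus, ζ, TangentField.derivation_star, sub_eq_add_neg]

theorem χminus_star (f : SF) : χminus (star f) = star (χplus f) := by
  simp [χplus, χminus, ζ, TangentField.derivation_star, sub_eq_add_neg]

end Operators

section Agree

/-- The field `f` coincides on the domain with the smooth function `F`. -/
def Agree (f : Fld) (F : SF) : Prop := ∀ x : dom, f x.1.1 x.1.2.1 x.1.2.2 = eval x F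

variable {f g : Fld} {F G : SF}

theorem SmoothFld.exists_agree (hf : SmoothFld f) : ∃ F, Agree f F := by
  obtain ⟨U, F, isOpen, emb_mem, contDiffOn, eq⟩ := hf
  exact ⟨⟨fun x => f x.1.1 x.1.2.1 x.1.2.2, U, F, isOpen, emb_mem, contDiffOn,
    fun x => eq _ x.2.1 _ x.2.2.1 _⟩, fun _ => rfl⟩

theorem Agree.hasDerivWithinAt (h : Agree f F) (V : TangentField) {γ : ℝ → ℝ × ℝ × SU2} {T : Set ℝ}
    {t : ℝ} {x : dom} (hx : γ t = x) (hγ : IsCurve γ T t (V.toFun (toAmb x))) :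
    HasDerivWithinAt (fun r => f (γ r).1 (γ r).2.1 (γ r).2.2) (eval x (V.derivation F)) T t := by
  have eq_extend {r : ℝ} (hr : r ∈ T) : f (γ r).1 (γ r).2.1 (γ r).2.2 = extend F (γ r) := by
    rw [extend_of_mem F (hγ.mapsTo hr), ← h]
  rw [← hx] at hγ
  have deriv_extend := V.hasDerivWithinAt F hγ
  rw [hx, extend_of_mem _ x.2] at deriv_extend
  exact deriv_extend.congr (fun r => eq_extend) (eq_extend hγ.mem)

theorem Agree.dτ (h : Agree f F) : Agree (dτ f) (δτ F) := fun x =>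
  ((h.hasDerivWithinAt fieldτ rfl (isCurve_τ x.2)).hasDerivAt (isOpen_Ioo.mem_nhds x.2.1)).deriv

theorem Agree.dρ (h : Agree f F) : Agree (dρ f) (δρ F) := fun x =>
  (h.hasDerivWithinAt fieldρ rfl (isCurve_ρ x.2)).derivWithin (uniqueDiffOn_Ici 0 _ x.2.2.1)

theorem Agree.Z (h : Agree f F) (i : Fin 3) : Agree (Z i f) (ζ i F) := fun x =>
  ((h.hasDerivWithinAt (fieldZ i) (orbit_zero i x)
    (isCurve_orbit_zero i x.2)).hasDerivAt Filter.univ_mem).deriv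

theorem Agree.iterate_dτ (h : Agree f F) (n : ℕ) : Agree (Spin2.dτ^[n] f) (δτ^[n] F) := by
  induction n with
  | zero => exact h
  | succ n ih =>
    rw [Function.iterate_succ_apply', Function.iterate_succ_apply']
    exact ih.dτ

theorem Agree.iterate_dρ (h : Agree f F) (n : ℕ) : Agree (Spin2.dρ^[n] f) (δρ^[n] F) := by
  induction n with
  | zero => exact h
  | succ n ih =>
    rw [Function.iterate_succ_apply', Function.iterate_succ_apply']
    exact ih.dρ

theorem Agree.Zword (h : Agree f F) (w : List (Fin 3)) : Agree (Zword w f) (wordEnd ζ w F) := by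
  induction w with
  | nil => exact h
  | cons i w ih => exact ih.Z i

theorem Agree.Xplus (h : Agree f F) : Agree (Xplus f) (χplus F) := fun x => by
  simp [Spin2.Xplus, χplus, h.Z _ x]

theorem Agree.Xminus (h : Agree f F) : Agree (Xminus f) (χminus F) := fun x => by
  simp [Spin2.Xminus, χminus, h.Z _ x]

theorem eval_coordτ (x : dom) : eval x coordτ = x.1.1 := rfl

theorem eval_coordρ (x : dom) : eval x coordρ = x.1.2.1 := rfl

theorem IsSpin2Solution.isPair {φ : Fin 5 → Fld} (hφ : IsSpin2Solution φ) {Φ : Fin 5 → SF}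
    (hΦ : ∀ k, Agree (φ k) (Φ k)) (k : Fin 4) :
    IsPair transL transM χplus χminus (2 - (k : ℕ)) (1 - (k : ℕ)) (Φ k.castSucc) (Φ k.succ) where
  left := by
    ext x
    have eqA := hφ.eqA k _ x.2.1 _ x.2.2.1 x.1.2.2
    rw [(hΦ _).dτ x, (hΦ _).dρ x, (hΦ _).Xplus x, hΦ _ x] at eqA
    simpa [transL_apply, eval_coordτ, eval_coordρ] using eqA
  right := by
    ext x
    have eqB := hφ.eqB k _ x.2.1 _ x.2.2.1 x.1.2.2
    rw [(hΦ _).dτ x, (hΦ _).dρ x, (hΦ _).Xminus x, hΦ _ x] at eqB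
    simpa [transM_apply, eval_coordτ, eval_coordρ] using eqB

end Agree

section Mixed

/-- `∂_τ^q ∂_ρ^r` on the smooth functions. -/
def mixed (q r : ℕ) : Module.End ℂ SF := (δτ : Module.End ℂ SF) ^ q * (δρ : Module.End ℂ SF) ^ r

theorem mixed_apply (q r : ℕ) (F : SF) : mixed q r F = δτ^[q] (δρ^[r] F) := by
  rw [mixed, Module.End.mul_apply, Module.End.pow_apply, Module.End.pow_apply]
  rfl

theorem commute_mixed_wordEnd (q r : ℕ) (w : List (Fin 3)) :
    Commute (mixed q r) (wordEnd ζ w) :=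
  ((commute_wordEnd lie_δτ_ζ w).pow_left q).mul_left ((commute_wordEnd lie_δρ_ζ w).pow_left r)

theorem isPair_mixed {a b : ℂ} {F G : SF} (h : IsPair transL transM χplus χminus a b F G)
    (q r : ℕ) :
    IsPair transL transM χplus χminus (a + q - r) (b - q + r) (mixed q r F) (mixed q r G) := by
  have hρ := h.iterate lie_δρ_transL lie_δρ_transM (lie_χplus_eq_zero lie_δρ_ζ)
    (lie_χminus_eq_zero lie_δρ_ζ) r
  have hτ := hρ.iterate lie_δτ_transL lie_δτ_transM (lie_χplus_eq_zero lie_δτ_ζ)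
    (lie_χminus_eq_zero lie_δτ_ζ) q
  rw [mixed_apply, mixed_apply]
  convert hτ using 1 <;> ring

end Mixed

section SymmetrizedProduct

/-- `Z^α` with `c = 1` on the smooth functions. -/
def Zop (α : Fin 3 → ℕ) : Module.End ℂ SF :=
  ((√((∏ i, (α i).factorial : ℕ) / ((∑ i, α i).factorial : ℕ) : ℝ) : ℝ) : ℂ) •
    ∑ w ∈ words α, wordEnd ζ (List.ofFn w)

theorem commute_mixed_Zop (q r : ℕ) (α : Fin 3 → ℕ) : Commute (mixed q r) (Zop α) :=
  (Commute.sum_right _ _ _ fun _ _ => commute_mixed_wordEnd q r _).smul_right _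

theorem Agree.D {f : Fld} {F : SF} (h : Agree f F) (c : ℝ) (q r : ℕ) (α : Fin 3 → ℕ) :
    Agree (D c q r α f) ((c : ℂ) • Zop α (mixed q r F)) := by
  have hZα : Agree (Zα c α f) ((c : ℂ) • Zop α F) := fun x => by
    simp only [Zα, Zop, (h.Zword _) x, LinearMap.smul_apply, LinearMap.sum_apply, map_smul, map_sum,
      smul_eq_mul, Complex.ofReal_mul, mul_assoc]
  have := (hZα.iterate_dρ r).iterate_dτ q
  rw [← mixed_apply, map_smul] at this
  rwa [← Module.End.mul_apply, (commute_mixed_Zop q r α).eq] at this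

end SymmetrizedProduct

section SumOfSquares

theorem exists_norm_sq_le_of_mem_span {𝕜 V κ : Type*} [NormedField 𝕜] [AddCommGroup V] [Module 𝕜 V]
    {B : κ → V} {t : Finset κ} {v : V} (hv : v ∈ Submodule.span 𝕜 (B '' t)) :
    ∃ C : ℝ, 0 ≤ C ∧ ∀ ℓ : V →ₗ[𝕜] 𝕜, ‖ℓ v‖ ^ 2 ≤ C * ∑ k ∈ t, ‖ℓ (B k)‖ ^ 2 := by
  obtain ⟨a, rfl⟩ := (Submodule.mem_span_image_finset_iff_exists_fun' 𝕜).1 hv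
  refine ⟨∑ k ∈ t, ‖a k‖ ^ 2, Finset.sum_nonneg fun _ _ => sq_nonneg _, fun ℓ => ?_⟩
  calc ‖ℓ (∑ k ∈ t, a k • B k)‖ ^ 2
      = ‖∑ k ∈ t, a k * ℓ (B k)‖ ^ 2 := by simp only [map_sum, map_smul, smul_eq_mul]
    _ ≤ (∑ k ∈ t, ‖a k‖ * ‖ℓ (B k)‖) ^ 2 := by
        gcongr
        exact (norm_sum_le _ _).trans_eq (Finset.sum_congr rfl fun _ _ => norm_mul _ _)
    _ ≤ _ := Finset.sum_mul_sq_le_sq_mul_sq _ _ _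

/-- The density `∑ |B_k F|²` of a finite family of operators. -/
def sqSum {κ : Type*} (t : Finset κ) (B : κ → Module.End ℂ SF) (F : SF) : SF :=
  ∑ k ∈ t, B k F * star (B k F)

variable {κ κ' : Type*} {t : Finset κ} {t' : Finset κ'} {B : κ → Module.End ℂ SF}
  {B' : κ' → Module.End ℂ SF}

theorem eval_sqSum (F : SF) (x : dom) :
    eval x (sqSum t B F) = ((∑ k ∈ t, ‖eval x (B k F)‖ ^ 2 : ℝ) : ℂ) := by
  simp only [sqSum, map_sum, map_mul, eval_star, Complex.ofReal_sum, Complex.ofReal_pow]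
  exact Finset.sum_congr rfl fun _ _ => Complex.mul_conj' _

theorem exists_sqSum_le (h : ∀ k ∈ t, B k ∈ Submodule.span ℂ (B' '' t')) :
    ∃ C : ℝ, 0 ≤ C ∧ ∀ (F : SF) (x : dom),
      (eval x (sqSum t B F)).re ≤ C * (eval x (sqSum t' B' F)).re := by
  choose! C hC hle using fun k hk => exists_norm_sq_le_of_mem_span (h k hk)
  refine ⟨∑ k ∈ t, C k, Finset.sum_nonneg hC, fun F x => ?_⟩
  rw [eval_sqSum, eval_sqSum, Complex.ofReal_re, Complex.ofReal_re, Finset.sum_mul]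
  exact Finset.sum_le_sum fun k hk =>
    hle k hk ((eval x).toLinearMap ∘ₗ LinearMap.applyₗ F)

theorem mul_mem_span_image {R : Type*} [CommSemiring R] {E : Type*} [Semiring E] [Algebra R E]
    {B : κ → E} {s : Set κ} {A : E} (hA : A ∈ Submodule.span R (B '' s)) (C : E) :
    A * C ∈ Submodule.span R ((fun k => B k * C) '' s) := by
  have := Submodule.mem_map_of_mem (f := LinearMap.mulRight R C) hA
  rwa [Submodule.map_span, image_image] at this

end SumOfSquares

section Comparison

variable {q r n m : ℕ}

theorem count_ofFn {ι : Type*} [DecidableEq ι] (w : Fin n → ι) (i : ι) :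
    (List.ofFn w).count i = (Finset.univ.filter fun j => w j = i).card := by
  induction n with
  | zero => simp
  | succ n ih =>
    rw [List.ofFn_succ, List.count_cons, ih, Fin.card_filter_univ_succ', add_comm]
    simp only [beq_iff_eq]

theorem mem_words {α : Fin 3 → ℕ} {w : Fin (∑ i, α i) → Fin 3} :
    w ∈ words α ↔ ∀ i, (List.ofFn w).count i = α i := by
  simp only [words, Finset.mem_filter, Finset.mem_univ, true_and, count_ofFn]

theorem sum_words {M : Type*} [AddCommMonoid M] (s : Multiset (Fin 3)) (g : List (Fin 3) → M) :
    ∑ w ∈ words fun i => s.count i, g (List.ofFn w) = ∑ w ∈ s.lists.toFinset, g w := by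
  refine Finset.sum_nbij List.ofFn (fun w hw => ?_) List.ofFn_injective.injOn (fun w hw => ?_)
    fun _ _ => rfl
  · exact mem_toFinset_lists.2 (Multiset.ext.2 fun i =>
      (Multiset.coe_count i _).trans (mem_words.1 hw i))
  · obtain rfl := mem_toFinset_lists.1 hw
    have length_eq : ∑ i, (w : Multiset (Fin 3)).count i = w.length :=
      Multiset.sum_count_eq_card fun i _ => Finset.mem_univ i
    have ofFn_eq : List.ofFn (w.get ∘ Fin.cast length_eq) = w :=
      (List.ofFn_congr length_eq.symm w.get).symm.trans (List.ofFn_get w)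
    exact ⟨_, mem_words.2 fun i => by rw [ofFn_eq, Multiset.coe_count], ofFn_eq⟩

theorem wordEnd_mem_span_Zop (w : List (Fin 3)) :
    wordEnd ζ w ∈ Submodule.span ℂ (Zop '' {α | ∑ i, α i ≤ w.length}) := by
  refine Submodule.span_le.2 ?_ (wordProd_mem_span_symProd lie_ζ_mem_span w)
  rintro _ ⟨s, hs, rfl⟩
  have weight_ne : ((√((∏ i, (s.count i).factorial : ℕ) / ((∑ i, s.count i).factorial : ℕ) : ℝ)
      : ℝ) : ℂ) ≠ 0 := by
    have prod_pos : 0 < ∏ i, (s.count i).factorial := Finset.prod_pos fun _ _ => Nat.factorial_pos _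
    exact Complex.ofReal_ne_zero.2
      (Real.sqrt_pos.2 (div_pos (mod_cast prod_pos) (mod_cast Nat.factorial_pos _))).ne'
  have Zop_mem : Zop (fun i => s.count i) ∈
      Submodule.span ℂ (Zop '' {α | ∑ i, α i ≤ w.length}) :=
    Submodule.subset_span
      ⟨_, (Multiset.sum_count_eq_card fun i _ => Finset.mem_univ i).trans_le hs, rfl⟩
  rw [Zop, sum_words s (wordEnd ζ)] at Zop_mem
  exact (Submodule.smul_mem_iff _ weight_ne).1 Zop_mem

theorem mem_indices {α : Fin 3 → ℕ} : (q, r, α) ∈ indices m ↔ q + r + ∑ i, α i ≤ m := by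
  simp only [indices, Finset.mem_filter, Finset.mem_product, Finset.mem_range,
    Fintype.mem_piFinset, and_iff_right_iff_imp]
  intro h
  have le_sum (i : Fin 3) : α i ≤ ∑ i, α i :=
    Finset.single_le_sum (fun _ _ => Nat.zero_le _) (Finset.mem_univ i)
  exact ⟨by lia, by lia, fun i => by have := le_sum i; lia⟩

/-- The orders `(q, r, n)` with `q + r + n ≤ m` of the operators `∂_τ^q ∂_ρ^r Z_{i₁} ⋯ Z_{i_n}`. -/
def orders (m : ℕ) : Finset (ℕ × ℕ × ℕ) :=
  (Finset.range (m + 1) ×ˢ Finset.range (m + 1) ×ˢ Finset.range (m + 1)).filter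
    fun x => x.1 + x.2.1 + x.2.2 ≤ m

theorem mem_orders : (q, r, n) ∈ orders m ↔ q + r + n ≤ m := by
  simp only [orders, Finset.mem_filter, Finset.mem_product, Finset.mem_range,
    and_iff_right_iff_imp]
  lia

/-- The triples `(q, r, w)` with `w` a word of length `n` and `q + r + n ≤ m`. -/
def wordIndices (m : ℕ) : Finset (Σ x : ℕ × ℕ × ℕ, Fin x.2.2 → Fin 3) :=
  (orders m).sigma fun _ => Finset.univ

/-- `∂_τ^q ∂_ρ^r Z_w` on the smooth functions. -/
def wordOp (i : Σ x : ℕ × ℕ × ℕ, Fin x.2.2 → Fin 3) : Module.End ℂ SF :=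
  wordEnd ζ (List.ofFn i.2) * mixed i.1.1 i.1.2.1

/-- `D^{q,r,α}` with `c = 1` on the smooth functions. -/
def symOp (i : ℕ × ℕ × (Fin 3 → ℕ)) : Module.End ℂ SF := Zop i.2.2 * mixed i.1 i.2.1

theorem wordOp_mem_span_symOp {i : Σ x : ℕ × ℕ × ℕ, Fin x.2.2 → Fin 3} (hi : i ∈ wordIndices m) :
    wordOp i ∈ Submodule.span ℂ (symOp '' (indices m : Set (ℕ × ℕ × (Fin 3 → ℕ)))) := by
  obtain ⟨⟨q, r, n⟩, w⟩ := i
  have order_le : q + r + n ≤ m := mem_orders.1 (Finset.mem_sigma.1 hi).1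
  refine Submodule.span_mono ?_ (mul_mem_span_image (wordEnd_mem_span_Zop _) _)
  rintro _ ⟨α, hα, rfl⟩
  have hα : ∑ i, α i ≤ n := by simpa using hα
  exact ⟨(q, r, α), mem_indices.2 (by lia), rfl⟩

theorem symOp_mem_span_wordOp {i : ℕ × ℕ × (Fin 3 → ℕ)} (hi : i ∈ indices m) :
    symOp i ∈ Submodule.span ℂ
      (wordOp '' (wordIndices m : Set (Σ x : ℕ × ℕ × ℕ, Fin x.2.2 → Fin 3))) := by
  obtain ⟨q, r, α⟩ := i
  rw [symOp, Zop, smul_mul_assoc, Finset.sum_mul]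
  refine Submodule.smul_mem _ _ (Submodule.sum_mem _ fun w _ => Submodule.subset_span ?_)
  exact ⟨⟨(q, r, ∑ i, α i), w⟩,
    Finset.mem_sigma.2 ⟨mem_orders.2 (mem_indices.1 hi), Finset.mem_univ _⟩, rfl⟩

theorem wordEnd_star (w : List (Fin 3)) (F : SF) : wordEnd ζ w (star F) = star (wordEnd ζ w F) := by
  induction w with
  | nil => rfl
  | cons i w ih => rw [wordEnd_cons, wordEnd_cons, ih, ζ, TangentField.derivation_star]

theorem sqSum_wordOp (m : ℕ) (F : SF) :
    sqSum (wordIndices m) wordOp F =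
      ∑ x ∈ orders m, wordForm ζ x.2.2 (mixed x.1 x.2.1 F) (star (mixed x.1 x.2.1 F)) := by
  simp only [sqSum, wordIndices, Finset.sum_sigma, wordForm_eq_sum, wordEnd_star]
  rfl

theorem Agree.density_eq {f : Fld} {F : SF} (h : Agree f F) (c : ℝ) (m : ℕ) (x : dom) :
    density c m f x.1.1 x.1.2.1 x.1.2.2 = c ^ 2 * (eval x (sqSum (indices m) symOp F)).re := by
  rw [density, eval_sqSum, Complex.ofReal_re, Finset.mul_sum]
  refine Finset.sum_congr rfl fun i _ => ?_
  rw [h.D c _ _ _ x, map_smul, norm_smul, mul_pow, Complex.norm_real, Real.norm_eq_abs, sq_abs]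
  rfl

end Comparison

section Haar

instance : haarSU2.IsHaarMeasure := by
  unfold haarSU2
  infer_instance

instance : IsProbabilityMeasure haarSU2 :=
  ⟨Measure.haarMeasure_self (K₀ := (⊤ : TopologicalSpace.PositiveCompacts SU2))⟩

theorem map_mul_right_haarSU2 (g : SU2) : haarSU2.map (· * g) = haarSU2 := by
  have : IsProbabilityMeasure (haarSU2.map (· * g)) :=
    Measure.isProbabilityMeasure_map (continuous_mul_const g).measurable.aemeasurable
  exact Measure.isHaarMeasure_eq_of_isProbabilityMeasure _ _

theorem integral_mul_right_haarSU2 {E : Type*} [NormedAddCommGroup E] [NormedSpace ℝ E]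
    (f : SU2 → E) (g : SU2) : ∫ s, f (s * g) ∂haarSU2 = ∫ s, f s ∂haarSU2 := by
  conv_rhs => rw [← map_mul_right_haarSU2 g]
  exact ((Homeomorph.mulRight g).measurableEmbedding.integral_map f).symm

theorem hasDerivAt_setIntegral_of_continuousOn {E Y : Type*} [NormedAddCommGroup E]
    [NormedSpace ℝ E] [TopologicalSpace Y] [MeasurableSpace Y] [OpensMeasurableSpace Y]
    {μ : Measure Y} [IsFiniteMeasureOnCompacts μ] {K : Set Y} (hK : IsCompact K)
    (hKm : MeasurableSet K) {I : Set ℝ} (hI : IsOpen I) {f f' : ℝ → Y → E}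
    (hf : ∀ x ∈ I, ContinuousOn (f x) K)
    (hf' : ContinuousOn (fun z : ℝ × Y => f' z.1 z.2) (I ×ˢ K))
    (hderiv : ∀ x ∈ I, ∀ y ∈ K, HasDerivAt (fun x => f x y) (f' x y) x) {x : ℝ} (hx : x ∈ I) :
    HasDerivAt (fun x => ∫ y in K, f x y ∂μ) (∫ y in K, f' x y ∂μ) x := by
  obtain ⟨ε, hε, hball⟩ := Metric.nhds_basis_closedBall.mem_iff.1 (hI.mem_nhds hx)
  obtain ⟨C, hC⟩ := ((isCompact_closedBall x ε).prod hK).exists_bound_of_continuousOn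
    (hf'.mono (prod_mono hball subset_rfl))
  have : IsFiniteMeasure (μ.restrict K) := ⟨by simpa using hK.measure_lt_top⟩
  have mem_K : ∀ᵐ y ∂μ.restrict K, y ∈ K := ae_restrict_mem hKm
  refine (hasDerivAt_integral_of_dominated_loc_of_deriv_le (bound := fun _ => C)
    (Metric.closedBall_mem_nhds x hε) ?_ ((hf x hx).integrableOn_compact' hK hKm) ?_ ?_
    (integrable_const C) ?_).2
  · filter_upwards [hI.mem_nhds hx] with z hz
    exact (hf z hz).aestronglyMeasurable_of_isCompact hK hKm
  · exact (hf'.comp (f := fun y => (x, y)) (by fun_prop)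
      fun y hy => ⟨hx, hy⟩).aestronglyMeasurable_of_isCompact hK hKm
  · filter_upwards [mem_K] with y hy z hz using hC (z, y) ⟨hz, hy⟩
  · filter_upwards [mem_K] with y hy z hz using hderiv z (hball hz) y hy

theorem continuous_expU (i : Fin 3) : Continuous (expU i) := by
  have continuous_emb := continuous_iff_continuousAt.2 fun l =>
    (hasDerivAt_emb_mul_expU i 1 l).continuousAt
  simp only [one_mul] at continuous_emb
  exact Continuous.subtype_mk continuous_emb _

-- The integral of a function does not change along the flow of `Z i`, which consists of right
-- translations.
theorem integral_ζ (i : Fin 3) (F : SF) (τ ρ : ℝ) :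
    ∫ s, extend (ζ i F) (τ, ρ, s) ∂haarSU2 = 0 := by
  by_cases hx : (τ, ρ, (1 : SU2)) ∈ dom
  · have mem_dom (s : SU2) : (τ, ρ, s) ∈ dom := ⟨hx.1, hx.2.1, mem_univ s⟩
    have continuous_slice (G : SF) : Continuous fun z : ℝ × SU2 =>
        extend G (τ, ρ, z.2 * expU i z.1) :=
      (continuousOn_extend G).comp_continuous (by have := continuous_expU i; fun_prop)
        fun _ => mem_dom _
    have deriv_integral := hasDerivAt_setIntegral_of_continuousOn (μ := haarSU2)
      isCompact_univ MeasurableSet.univ isOpen_univ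
      (f := fun l s => extend F (orbit i (τ, ρ, s) l))
      (f' := fun l s => extend (ζ i F) (orbit i (τ, ρ, s) l))
      (fun l _ => ((continuous_slice F).comp (Continuous.prodMk_right l)).continuousOn)
      (continuous_slice (ζ i F)).continuousOn
      (fun l _ s _ => ((fieldZ i).hasDerivWithinAt F
        (isCurve_orbit i (mem_dom s) l)).hasDerivAt Filter.univ_mem) (mem_univ 0)
    have invariant (G : SF) (l : ℝ) : ∫ s, extend G (orbit i (τ, ρ, s) l) ∂haarSU2 =
        ∫ s, extend G (τ, ρ, s) ∂haarSU2 :=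
      integral_mul_right_haarSU2 (fun s => extend G (τ, ρ, s)) (expU i l)
    simp only [Measure.restrict_univ, invariant] at deriv_integral
    exact deriv_integral.unique (hasDerivAt_const (0 : ℝ) _)
  · have notMem_dom (s : SU2) : (τ, ρ, s) ∉ dom := fun h => hx ⟨h.1, h.2.1, mem_univ _⟩
    simp only [extend_of_notMem _ (notMem_dom _), integral_zero]

end Haar

section Comoving

/-- The slice `0 ≤ σ ≤ ρs` in the coordinates `(σ, s)`, `σ = (1 + τ) ρ`. -/
def slab (ρs : ℝ) : Set (ℝ × SU2) := Icc 0 ρs ×ˢ univ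

theorem isCompact_slab (ρs : ℝ) : IsCompact (slab ρs) := isCompact_Icc.prod isCompact_univ

theorem measurableSet_slab (ρs : ℝ) : MeasurableSet (slab ρs) :=
  measurableSet_Icc.prod MeasurableSet.univ

/-- The point with coordinates `(τ, σ, s)`, `σ = (1 + τ) ρ`. The curves `σ = const` are the
characteristics of `(1 + τ) ∂_τ - ρ ∂_ρ`. -/
def comoving (x : ℝ × ℝ × SU2) : ℝ × ℝ × SU2 := (x.1, x.2.1 / (1 + x.1), x.2.2)

theorem one_add_pos {x : ℝ × ℝ × SU2} (hx : x ∈ dom) : 0 < 1 + x.1 := by linarith [hx.1.1]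

theorem mapsTo_comoving : MapsTo comoving dom dom := fun _ hx =>
  ⟨hx.1, div_nonneg hx.2.1 (one_add_pos hx).le, mem_univ _⟩

theorem continuousOn_comoving : ContinuousOn comoving dom :=
  continuousOn_fst.prodMk ((ContinuousOn.div (by fun_prop) (by fun_prop)
    fun _ hx => (one_add_pos hx).ne').prodMk (by fun_prop))

theorem prod_slab_subset_dom (ρs : ℝ) : Ioo (-1) 1 ×ˢ slab ρs ⊆ dom := fun _ hz =>
  ⟨hz.1, hz.2.1.1, mem_univ _⟩

variable {E : Type*} [NormedAddCommGroup E] {f : ℝ × ℝ × SU2 → E} {τ : ℝ}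

theorem continuousOn_slab (hf : ContinuousOn f dom) (hτ : τ ∈ Ioo (-1 : ℝ) 1) (ρs : ℝ) :
    ContinuousOn (fun y : ℝ × SU2 => f (τ, y)) (slab ρs) :=
  hf.comp (by fun_prop) fun _ hy => prod_slab_subset_dom ρs ⟨hτ, hy⟩

theorem integrableOn_slab (hf : ContinuousOn f dom) (hτ : τ ∈ Ioo (-1 : ℝ) 1) (ρs : ℝ) :
    IntegrableOn (fun y : ℝ × SU2 => f (τ, y)) (slab ρs) (volume.prod haarSU2) :=
  (continuousOn_slab hf hτ ρs).integrableOn_compact' (isCompact_slab ρs) (measurableSet_slab ρs)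

end Comoving

section Average

theorem extend_add (F G : SF) (x : ℝ × ℝ × SU2) : extend (F + G) x = extend F x + extend G x := by
  by_cases hx : x ∈ dom
  · simp only [extend_of_mem _ hx, map_add]
  · simp only [extend_of_notMem _ hx, add_zero]

theorem extend_smul (c : ℂ) (F : SF) (x : ℝ × ℝ × SU2) : extend (c • F) x = c • extend F x := by
  by_cases hx : x ∈ dom
  · simp only [extend_of_mem _ hx, map_smul]
  · simp only [extend_of_notMem _ hx, smul_zero]

theorem continuousOn_extend_comoving (F : SF) :
    ContinuousOn (fun x => extend F (comoving x)) dom :=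
  (continuousOn_extend F).comp continuousOn_comoving mapsTo_comoving

theorem integrableOn_extend_comoving (F : SF) (ρs τ : ℝ) :
    IntegrableOn (fun y => extend F (comoving (τ, y))) (slab ρs) (volume.prod haarSU2) := by
  by_cases hτ : τ ∈ Ioo (-1 : ℝ) 1
  · exact integrableOn_slab (continuousOn_extend_comoving F) hτ ρs
  · have notMem_dom (y : ℝ × SU2) : comoving (τ, y) ∉ dom := fun h => hτ h.1
    simp only [extend_of_notMem _ (notMem_dom _)]
    exact integrableOn_zero

/-- The integral over the slice `0 ≤ (1 + τ) ρ ≤ ρs` with respect to `d((1 + τ) ρ) dμ`. -/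
def avg (ρs τ : ℝ) : SF →ₗ[ℂ] ℂ where
  toFun F := ∫ y in slab ρs, extend F (comoving (τ, y)) ∂(volume.prod haarSU2)
  map_add' F G := by
    simp only [extend_add]
    exact integral_add (integrableOn_extend_comoving F ρs τ) (integrableOn_extend_comoving G ρs τ)
  map_smul' c F := by
    simp only [extend_smul]
    exact integral_smul c _

theorem avg_apply (ρs τ : ℝ) (F : SF) :
    avg ρs τ F = ∫ y in slab ρs, extend F (comoving (τ, y)) ∂(volume.prod haarSU2) := rfl

theorem re_avg (ρs τ : ℝ) (F : SF) :
    (avg ρs τ F).re =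
      ∫ y in slab ρs, (extend F (comoving (τ, y))).re ∂(volume.prod haarSU2) :=
  (integral_re (integrableOn_extend_comoving F ρs τ)).symm

theorem re_extend_nonneg {F : SF} (hF : ∀ x, 0 ≤ (eval x F).re) (x : ℝ × ℝ × SU2) :
    0 ≤ (extend F x).re := by
  by_cases hx : x ∈ dom
  · rw [extend_of_mem F hx]
    exact hF _
  · rw [extend_of_notMem F hx, Complex.zero_re]

theorem re_avg_nonneg (ρs τ : ℝ) {F : SF} (hF : ∀ x, 0 ≤ (eval x F).re) :
    0 ≤ (avg ρs τ F).re := by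
  rw [re_avg]
  exact integral_nonneg fun _ => re_extend_nonneg hF _

theorem re_avg_le_mul (ρs τ : ℝ) {F G : SF} {C : ℝ}
    (h : ∀ x, (eval x F).re ≤ C * (eval x G).re) :
    (avg ρs τ F).re ≤ C * (avg ρs τ G).re := by
  have := re_avg_nonneg ρs τ (F := (C : ℂ) • G - F) fun x => by
    simpa only [map_sub, map_smul, smul_eq_mul, Complex.sub_re, Complex.re_ofReal_mul,
      sub_nonneg] using h x
  simpa only [map_sub, map_smul, smul_eq_mul, Complex.sub_re, Complex.re_ofReal_mul,
    sub_nonneg] using this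

theorem avg_coordτ_mul (ρs τ : ℝ) (F : SF) : avg ρs τ (coordτ * F) = τ * avg ρs τ F := by
  rw [avg_apply, avg_apply, ← integral_const_mul]
  congr 1 with y
  by_cases hx : comoving (τ, y) ∈ dom
  · rw [extend_of_mem _ hx, extend_of_mem _ hx, map_mul, eval_coordτ]
    rfl
  · rw [extend_of_notMem _ hx, extend_of_notMem _ hx, mul_zero]

theorem avg_ζ (ρs τ : ℝ) (i : Fin 3) (F : SF) : avg ρs τ (ζ i F) = 0 := by
  rw [avg_apply, slab, setIntegral_prod _ (integrableOn_extend_comoving (ζ i F) ρs τ),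
    Measure.restrict_univ]
  exact setIntegral_eq_zero_of_forall_eq_zero fun σ _ => integral_ζ i F τ (σ / (1 + τ))

theorem avg_χplus (ρs τ : ℝ) (F : SF) : avg ρs τ (χplus F) = 0 := by
  simp [χplus, avg_ζ]

theorem avg_χminus (ρs τ : ℝ) (F : SF) : avg ρs τ (χminus F) = 0 := by
  simp [χminus, avg_ζ]

end Average

section TimeDerivative

theorem TangentField.hasDerivWithinAt_add_smul (V W : TangentField) (f : SF)
    {γ : ℝ → ℝ × ℝ × SU2} {T : Set ℝ} {t a b : ℝ}
    (hγ : IsCurve γ T t (a • V.toFun (toAmb (γ t)) + b • W.toFun (toAmb (γ t)))) :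
    HasDerivWithinAt (fun r => extend f (γ r))
      (a * extend (V.derivation f) (γ t) + b * extend (W.derivation f) (γ t)) T t := by
  obtain ⟨U, F, h⟩ := f.2
  have hx := hγ.mapsTo hγ.mem
  have := h.hasDerivWithinAt hγ
  rw [map_add, map_smul, map_smul] at this
  rwa [(V.isExt_derivation h).extend_eq hx, (W.isExt_derivation h).extend_eq hx]

theorem isCurve_comoving {x : ℝ × ℝ × SU2} (hx : x ∈ dom) :
    IsCurve (fun r => comoving (r, x.2)) (Ioo (-1) 1) x.1 (1, -x.2.1 / (1 + x.1) ^ 2, 0) := by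
  refine ⟨hx.1, fun _ hr => mapsTo_comoving ⟨hr, hx.2⟩, (hasDerivWithinAt_id _ _).prodMk
    (HasDerivWithinAt.prodMk ?_ (hasDerivWithinAt_const _ _ (emb x.2.2)))⟩
  exact (((hasDerivAt_const x.1 x.2.1).div ((hasDerivAt_id x.1).const_add 1)
    (one_add_pos hx).ne').congr_deriv (by simp)).hasDerivWithinAt

theorem hasDerivAt_extend_comoving (F : SF) {x : ℝ × ℝ × SU2} (hx : x ∈ dom) :
    HasDerivAt (fun r => extend F (comoving (r, x.2)))
      (extend (transL F) (comoving x) / (1 + x.1 : ℝ)) x.1 := by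
  have one_add_ne : ((1 + x.1 : ℝ) : ℂ) ≠ 0 := Complex.ofReal_ne_zero.2 (one_add_pos hx).ne'
  have curve := isCurve_comoving hx
  rw [show ((1, -x.2.1 / (1 + x.1) ^ 2, 0) : Amb) = (1 : ℝ) • (1, 0, 0) +
    (-x.2.1 / (1 + x.1) ^ 2) • (0, 1, 0) by simp] at curve
  refine ((fieldτ.hasDerivWithinAt_add_smul fieldρ F curve).hasDerivAt
    (isOpen_Ioo.mem_nhds hx.1)).congr_deriv ?_
  rw [eq_div_iff one_add_ne, extend_of_mem _ (mapsTo_comoving hx),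
    extend_of_mem _ (mapsTo_comoving hx), extend_of_mem _ (mapsTo_comoving hx), transL_apply]
  simp only [map_sub, map_mul, map_add, map_one, eval_coordτ, eval_coordρ, comoving]
  push_cast at one_add_ne ⊢
  field_simp
  simp only [δτ, δρ]
  ring

theorem hasDerivAt_avg (ρs : ℝ) {τ : ℝ} (hτ : τ ∈ Ioo (-1 : ℝ) 1) (F : SF) :
    HasDerivAt (fun τ => avg ρs τ F) (avg ρs τ (transL F) / (1 + τ : ℝ)) τ := by
  rw [avg_apply, ← integral_div]
  refine hasDerivAt_setIntegral_of_continuousOn (isCompact_slab ρs) (measurableSet_slab ρs)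
    isOpen_Ioo (f' := fun τ y => extend (transL F) (comoving (τ, y)) / (1 + τ : ℝ))
    (fun x hx => continuousOn_slab (continuousOn_extend_comoving F) hx ρs) ?_
    (fun x hx y hy =>
      hasDerivAt_extend_comoving F (x := (x, y)) (prod_slab_subset_dom ρs ⟨hx, hy⟩)) hτ
  refine ((continuousOn_extend_comoving (transL F)).mono (prod_slab_subset_dom ρs)).div
    (by fun_prop) fun z hz => Complex.ofReal_ne_zero.2 ?_
  exact (one_add_pos (prod_slab_subset_dom ρs hz)).ne'

theorem hasDerivAt_re_avg (ρs : ℝ) {τ : ℝ} (hτ : τ ∈ Ioo (-1 : ℝ) 1) (F : SF) :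
    HasDerivAt (fun τ => (avg ρs τ F).re) ((avg ρs τ (transL F)).re / (1 + τ)) τ :=
  (Complex.reCLM.hasFDerivAt.comp_hasDerivAt τ (hasDerivAt_avg ρs hτ F)).congr_deriv
    (Complex.div_ofReal_re _ _)

theorem hasDerivWithinAt_extend_comoving_radial (F : SF) {x : ℝ × ℝ × SU2} (hx : x ∈ dom) :
    HasDerivWithinAt (fun σ => extend F (comoving (x.1, σ, x.2.2)))
      (extend (δρ F) (comoving x) / (1 + x.1 : ℝ)) (Ici 0) x.2.1 := by
  have scaling : HasDerivWithinAt (fun σ : ℝ => σ / (1 + x.1)) (1 / (1 + x.1)) (Ici 0) x.2.1 :=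
    (hasDerivWithinAt_id _ _).div_const _
  refine (HasDerivWithinAt.scomp x.2.1
    (fieldρ.hasDerivWithinAt F (isCurve_ρ (mapsTo_comoving hx))) scaling
    fun σ hσ => div_nonneg hσ (one_add_pos hx).le).congr_deriv ?_
  rw [Complex.real_smul, Complex.ofReal_div, Complex.ofReal_one, one_div, inv_mul_eq_div]
  rfl

-- The integrand is the derivative of `σ ↦ σ Q` at fixed `τ`.
theorem avg_coordρ_mul_δρ_add {τ : ℝ} (hτ : τ ∈ Ioo (-1 : ℝ) 1) {ρs : ℝ} (hρs : 0 ≤ ρs) (Q : SF) :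
    avg ρs τ (coordρ * δρ Q + Q) =
      ∫ s, ρs * extend Q (comoving (τ, ρs, s)) ∂haarSU2 := by
  set F := coordρ * δρ Q + Q with hF
  rw [avg_apply, slab, ← Measure.prod_restrict, integral_prod_symm _
    (by rw [Measure.prod_restrict]; exact integrableOn_extend_comoving F ρs τ),
    Measure.restrict_univ]
  congr 1 with s
  have mem_dom {σ : ℝ} (hσ : 0 ≤ σ) : (τ, σ, s) ∈ dom := ⟨hτ, hσ, mem_univ _⟩
  have continuousOn_line (G : SF) :
      ContinuousOn (fun σ => extend G (comoving (τ, σ, s))) (Icc 0 ρs) :=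
    (continuousOn_extend_comoving G).comp (f := fun σ => (τ, σ, s)) (by fun_prop)
      fun _ hσ => mem_dom hσ.1
  have deriv_line (σ : ℝ) (hσ : σ ∈ Ioo 0 ρs) :
      HasDerivWithinAt (fun σ : ℝ => (σ : ℂ) * extend Q (comoving (τ, σ, s)))
        (extend F (comoving (τ, σ, s))) (Ioi σ) σ := by
    have hx := mem_dom hσ.1.le
    have product := (HasDerivAt.ofReal_comp (hasDerivAt_id σ)).hasDerivWithinAt.mul
      (hasDerivWithinAt_extend_comoving_radial Q hx)
    refine (product.congr_deriv ?_).mono (Ioi_subset_Ici hσ.1.le)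
    rw [hF, extend_add, extend_of_mem _ (mapsTo_comoving hx), extend_of_mem _ (mapsTo_comoving hx),
      extend_of_mem _ (mapsTo_comoving hx), map_mul, eval_coordρ]
    simp only [comoving, id, Complex.ofReal_div, Complex.ofReal_one]
    ring
  rw [integral_Icc_eq_integral_Ioc, ← intervalIntegral.integral_of_le hρs,
    intervalIntegral.integral_eq_sub_of_hasDeriv_right_of_le hρs
      (ContinuousOn.mul (by fun_prop) (continuousOn_line Q)) deriv_line
      ((continuousOn_line F).intervalIntegrable_of_Icc hρs)]
  simp

theorem re_avg_coordρ_mul_δρ_add_nonneg {τ : ℝ} (hτ : τ ∈ Ioo (-1 : ℝ) 1) {ρs : ℝ}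
    (hρs : 0 ≤ ρs) {Q : SF} (hQ : ∀ x, 0 ≤ (eval x Q).re) :
    0 ≤ (avg ρs τ (coordρ * δρ Q + Q)).re := by
  have continuous_boundary : Continuous fun s => (ρs : ℂ) * extend Q (comoving (τ, ρs, s)) :=
    continuous_const.mul ((continuousOn_extend_comoving Q).comp_continuous (by fun_prop)
      fun s => ⟨hτ, hρs, mem_univ s⟩)
  rw [avg_coordρ_mul_δρ_add hτ hρs, ← RCLike.re_eq_complex_re, ← integral_re
    (continuous_boundary.integrable_of_hasCompactSupport (HasCompactSupport.of_compactSpace _))]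
  refine integral_nonneg fun s => ?_
  rw [RCLike.re_eq_complex_re, Complex.re_ofReal_mul]
  exact mul_nonneg hρs (re_extend_nonneg hQ _)

end TimeDerivative

section Gronwall

theorem add_integral_le_mul_exp {E E' h : ℝ → ℝ} {a b κ : ℝ} (hab : a ≤ b) (hκ : 0 ≤ κ)
    (hE : ContinuousOn E (Icc a b)) (hE' : ∀ x ∈ Ico a b, HasDerivWithinAt E (E' x) (Ici x) x)
    (hh : ContinuousOn h (Icc a b)) (h_nonneg : ∀ x ∈ Icc a b, 0 ≤ h x)
    (hle : ∀ x ∈ Ico a b, E' x ≤ κ * E x - h x) :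
    E b + ∫ x in a..b, h x ≤ E a * Real.exp (κ * (b - a)) := by
  have integral_deriv (x : ℝ) (hx : x ∈ Ico a b) :
      HasDerivWithinAt (fun y => ∫ z in a..y, h z) (h x) (Ici x) x := by
    have near : Icc a b ∈ nhdsWithin x (Ici x) :=
      Filter.mem_of_superset (Icc_mem_nhdsGE hx.2) (Icc_subset_Icc_left hx.1)
    have near' : Icc a b ∈ nhdsWithin x (Ioi x) := nhdsWithin_mono x Ioi_subset_Ici_self near
    refine intervalIntegral.integral_hasDerivWithinAt_right
      ((hh.mono (Icc_subset_Icc_right hx.2.le)).intervalIntegrable_of_Icc hx.1) ?_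
      ((hh x (Ico_subset_Icc_self hx)).mono_of_mem_nhdsWithin near')
    exact ⟨_, near', hh.aestronglyMeasurable measurableSet_Icc⟩
  have gronwall := le_gronwallBound_of_liminf_deriv_right_le (K := κ) (ε := 0)
    (f := fun x => E x + ∫ y in a..x, h y) (f' := fun x => E' x + h x)
    (hE.add (intervalIntegral.continuousOn_primitive_interval'
      (hh.intervalIntegrable_of_Icc hab) left_mem_uIcc |>.mono (by rw [uIcc_of_le hab])))
    (fun x hx r hr => ((hE' x hx).add (integral_deriv x hx)).liminf_right_slope_le hr) le_rfl
    (fun x hx => by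
      have integral_nonneg : 0 ≤ ∫ y in a..x, h y := intervalIntegral.integral_nonneg hx.1
        fun y hy => h_nonneg y ⟨hy.1, hy.2.trans hx.2.le⟩
      linarith [hle x hx, mul_nonneg hκ integral_nonneg]) b (right_mem_Icc.2 hab)
  simpa only [gronwallBound_ε0, intervalIntegral.integral_same, add_zero] using gronwall

end Gronwall

section Bulk

variable {ρs t : ℝ}

theorem N_subset_dom (ρs : ℝ) (ht : t < 1) : N ρs t ⊆ dom := fun x hx =>
  ⟨⟨by linarith [hx.1], hx.2.1.trans_lt ht⟩, hx.2.2.1, mem_univ _⟩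

theorem isCompact_N (ρs t : ℝ) : IsCompact (N ρs t) := by
  have N_eq : N ρs t = (Icc 0 t ×ˢ Icc 0 ρs ×ˢ univ) ∩ {x | x.2.1 * (1 + x.1) ≤ ρs} := by
    ext x
    constructor
    · rintro ⟨h0, ht, hρ, hρs⟩
      rw [le_div_iff₀ (by linarith)] at hρs
      exact ⟨⟨⟨h0, ht⟩, ⟨hρ, by nlinarith⟩, mem_univ _⟩, hρs⟩
    · rintro ⟨⟨⟨h0, ht⟩, ⟨hρ, -⟩, -⟩, hρs⟩
      exact ⟨h0, ht, hρ, (le_div_iff₀ (by linarith)).2 hρs⟩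
  rw [N_eq]
  exact (isCompact_Icc.prod (isCompact_Icc.prod isCompact_univ)).inter_right
    (isClosed_le (by fun_prop) continuous_const)

theorem measurableSet_N (ρs t : ℝ) : MeasurableSet (N ρs t) :=
  (isCompact_N ρs t).isClosed.measurableSet

theorem S_eq_slab (ρs t : ℝ) : S ρs t = slab (ρs / (1 + t)) := by
  ext y
  simp [S, slab]

theorem S_zero (ρs : ℝ) : S ρs 0 = slab ρs := by
  rw [S_eq_slab, add_zero, div_one]

variable {f : ℝ × ℝ × SU2 → ℝ}

theorem integrableOn_N (hf : ContinuousOn f dom) (ρs : ℝ) (ht : t < 1) :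
    IntegrableOn f (N ρs t) (volume.prod (volume.prod haarSU2)) :=
  (hf.mono (N_subset_dom ρs ht)).integrableOn_compact' (isCompact_N ρs t) (measurableSet_N ρs t)

theorem integral_S_eq (hf : ContinuousOn f dom) (hρs : 0 ≤ ρs) {τ : ℝ}
    (hτ : τ ∈ Ioo (-1 : ℝ) 1) :
    ∫ y in S ρs τ, f (τ, y) ∂(volume.prod haarSU2) =
      (∫ y in slab ρs, f (comoving (τ, y)) ∂(volume.prod haarSU2)) / (1 + τ) := by
  have one_add_pos : 0 < 1 + τ := by linarith [hτ.1]
  have integrable_comoving : IntegrableOn (fun y => f (comoving (τ, y))) (slab ρs)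
      (volume.prod haarSU2) :=
    integrableOn_slab (hf.comp continuousOn_comoving mapsTo_comoving) hτ ρs
  rw [S_eq_slab, slab, setIntegral_prod _ (integrableOn_slab hf hτ _), slab,
    setIntegral_prod _ integrable_comoving, integral_Icc_eq_integral_Ioc,
    integral_Icc_eq_integral_Ioc, ← intervalIntegral.integral_of_le (div_nonneg hρs one_add_pos.le),
    ← intervalIntegral.integral_of_le hρs]
  simp only [comoving]
  rw [intervalIntegral.integral_comp_div
      (fun ρ => ∫ s in univ, f (τ, ρ, s) ∂haarSU2) one_add_pos.ne', zero_div, smul_eq_mul,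
    mul_div_cancel_left₀ _ one_add_pos.ne']

theorem integral_N_eq (hf : ContinuousOn f dom) (ρs : ℝ) (ht : t ∈ Ico (0 : ℝ) 1) :
    ∫ x in N ρs t, f x ∂(volume.prod (volume.prod haarSU2)) =
      ∫ τ in (0 : ℝ)..t, ∫ y in S ρs τ, f (τ, y) ∂(volume.prod haarSU2) := by
  have measurableSet_S (τ : ℝ) : MeasurableSet (S ρs τ) := by
    rw [S_eq_slab]
    exact measurableSet_slab _
  rw [← integral_indicator (measurableSet_N ρs t),
    integral_prod _ ((integrableOn_N hf ρs ht.2).integrable_indicator (measurableSet_N ρs t)),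
    intervalIntegral.integral_of_le ht.1, ← integral_Icc_eq_integral_Ioc,
    ← integral_indicator measurableSet_Icc]
  congr 1 with τ
  by_cases hτ : τ ∈ Icc 0 t
  · rw [indicator_of_mem hτ, ← integral_indicator (measurableSet_S τ)]
    congr 1 with y
    exact indicator_eq_indicator ⟨fun h => h.2.2, fun h => ⟨hτ.1, hτ.2, h⟩⟩ rfl
  · have notMem_N (y : ℝ × SU2) : (τ, y) ∉ N ρs t := fun h => hτ ⟨h.1, h.2.1⟩
    simp only [indicator_of_notMem hτ, indicator_of_notMem (notMem_N _), integral_zero]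

/-- The integral of `Re F` over `N_t`. -/
def bulk (ρs t : ℝ) (F : SF) : ℝ :=
  ∫ x in N ρs t, (extend F x).re ∂(volume.prod (volume.prod haarSU2))

theorem continuousOn_re_extend (F : SF) : ContinuousOn (fun x => (extend F x).re) dom :=
  Complex.continuous_re.comp_continuousOn (continuousOn_extend F)

theorem bulk_eq (hρs : 0 ≤ ρs) (ht : t ∈ Ico (0 : ℝ) 1) (F : SF) :
    bulk ρs t F = ∫ τ in (0 : ℝ)..t, (avg ρs τ F).re / (1 + τ) := by
  rw [bulk, integral_N_eq (continuousOn_re_extend F) ρs ht]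
  refine intervalIntegral.integral_congr fun τ hτ => ?_
  rw [uIcc_of_le ht.1] at hτ
  simp only [re_avg]
  exact integral_S_eq (continuousOn_re_extend F) hρs ⟨by linarith [hτ.1], hτ.2.trans_lt ht.2⟩

theorem bulk_le_mul (ρs : ℝ) (ht : t < 1) {F G : SF} {C : ℝ}
    (h : ∀ x, (eval x F).re ≤ C * (eval x G).re) : bulk ρs t F ≤ C * bulk ρs t G := by
  rw [bulk, bulk, ← integral_const_mul]
  refine setIntegral_mono_on (integrableOn_N (continuousOn_re_extend F) ρs ht)
    ((integrableOn_N (continuousOn_re_extend G) ρs ht).const_mul C) (measurableSet_N ρs t)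
    fun x hx => ?_
  have hx := N_subset_dom ρs ht hx
  rw [extend_of_mem F hx, extend_of_mem G hx]
  exact h _

end Bulk

section Energy

variable {ρs : ℝ} {F G : SF}

theorem re_avg_transL (ρs τ : ℝ) (G : SF) :
    (1 - τ) * (avg ρs τ (transL G)).re =
      (1 + τ) * (avg ρs τ (transM G)).re - 2 * (avg ρs τ (coordρ * δρ G)).re := by
  have transL_eq : (1 - coordτ) * transL G =
      (1 + coordτ) * transM G - (2 : ℂ) • (coordρ * δρ G) := by
    rw [two_smul, transL_apply, transM_apply]
    ring
  have avg_eq := congr((avg ρs τ $transL_eq).re)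
  simp only [sub_mul, add_mul, one_mul, map_sub, map_add, map_smul, avg_coordτ_mul, smul_eq_mul,
    Complex.sub_re, Complex.add_re, Complex.re_ofReal_mul] at avg_eq
  have two_mul_re (z : ℂ) : ((2 : ℂ) * z).re = 2 * z.re := by simp
  rw [two_mul_re] at avg_eq
  linarith

/-- The energy of a pair of densities on the slice `τ`. The weight of the second density is the
ratio of the coefficients of `∂_τ` in `transM` and `transL`. -/
def energy (ρs : ℝ) (F G : SF) (τ : ℝ) : ℝ :=
  (avg ρs τ F).re + (1 - τ) / (1 + τ) * (avg ρs τ G).re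

theorem hasDerivAt_energy (ρs : ℝ) (F G : SF) {τ : ℝ} (hτ : τ ∈ Ioo (-1 : ℝ) 1) :
    HasDerivAt (energy ρs F G)
      ((avg ρs τ (transL F + transM G)).re / (1 + τ)
        - 2 * (avg ρs τ (coordρ * δρ G + G)).re / (1 + τ) ^ 2) τ := by
  have one_add_ne : 1 + τ ≠ 0 := by linarith [hτ.1]
  have weight_deriv : HasDerivAt (fun τ : ℝ => (1 - τ) / (1 + τ)) (-2 / (1 + τ) ^ 2) τ :=
    (((hasDerivAt_id τ).const_sub 1).div ((hasDerivAt_id τ).const_add 1) one_add_ne).congr_deriv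
      (by simp only [id]; ring)
  refine ((hasDerivAt_re_avg ρs hτ F).add
    (weight_deriv.mul (hasDerivAt_re_avg ρs hτ G))).congr_deriv ?_
  have := re_avg_transL ρs τ G
  simp only [map_add, Complex.add_re]
  field_simp
  linarith

theorem re_avg_le_energy (ρs : ℝ) (F : SF) (hG : ∀ x, 0 ≤ (eval x G).re) {τ : ℝ}
    (hτ : τ ∈ Ico (0 : ℝ) 1) : (avg ρs τ F).re ≤ energy ρs F G τ :=
  le_add_of_nonneg_right (mul_nonneg (div_nonneg (by linarith [hτ.2]) (by linarith [hτ.1]))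
    (re_avg_nonneg ρs τ hG))

theorem deriv_energy_le (hρs : 0 ≤ ρs) {κ : ℝ} (hκ : 0 ≤ κ) (hF : ∀ x, 0 ≤ (eval x F).re)
    (hG : ∀ x, 0 ≤ (eval x G).re) {τ : ℝ} (hτ : τ ∈ Ico (0 : ℝ) 1)
    (hle : (avg ρs τ (transL F + transM G + (F + G))).re ≤ κ * (avg ρs τ F).re) :
    (avg ρs τ (transL F + transM G)).re / (1 + τ)
        - 2 * (avg ρs τ (coordρ * δρ G + G)).re / (1 + τ) ^ 2 ≤
      κ * energy ρs F G τ - (avg ρs τ (F + G)).re / (1 + τ) := by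
  have one_le : 1 ≤ 1 + τ := by linarith [hτ.1]
  have flux_nonneg : 0 ≤ 2 * (avg ρs τ (coordρ * δρ G + G)).re / (1 + τ) ^ 2 := by
    have := re_avg_coordρ_mul_δρ_add_nonneg ⟨by linarith, hτ.2⟩ hρs hG
    positivity
  have source_le := div_le_div_of_nonneg_right hle (zero_le_one.trans one_le)
  rw [map_add, Complex.add_re, add_div] at source_le
  have avg_le : κ * (avg ρs τ F).re / (1 + τ) ≤ κ * energy ρs F G τ :=
    (div_le_self (mul_nonneg hκ (re_avg_nonneg ρs τ hF)) one_le).trans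
      (mul_le_mul_of_nonneg_left (re_avg_le_energy ρs F hG hτ) hκ)
  linarith

theorem bulk_add_le (hρs : 0 ≤ ρs) {κ : ℝ} (hκ : 0 ≤ κ) (hF : ∀ x, 0 ≤ (eval x F).re)
    (hG : ∀ x, 0 ≤ (eval x G).re)
    (hle : ∀ τ, (avg ρs τ (transL F + transM G + (F + G))).re ≤ κ * (avg ρs τ F).re)
    {t : ℝ} (ht : t ∈ Ico (0 : ℝ) 1) :
    bulk ρs t (F + G) ≤ Real.exp κ * (avg ρs 0 (F + G)).re := by
  have mem_Ioo {τ : ℝ} (hτ : τ ∈ Icc 0 t) : τ ∈ Ioo (-1 : ℝ) 1 :=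
    ⟨by linarith [hτ.1], hτ.2.trans_lt ht.2⟩
  have avg_nonneg (τ : ℝ) : 0 ≤ (avg ρs τ (F + G)).re := by
    rw [map_add, Complex.add_re]
    exact add_nonneg (re_avg_nonneg ρs τ hF) (re_avg_nonneg ρs τ hG)
  have energy_deriv {τ : ℝ} (hτ : τ ∈ Icc 0 t) := hasDerivAt_energy ρs F G (mem_Ioo hτ)
  have avg_continuous : ContinuousOn (fun τ => (avg ρs τ (F + G)).re / (1 + τ)) (Icc 0 t) :=
    fun τ hτ => ((hasDerivAt_re_avg ρs (mem_Ioo hτ) (F + G)).continuousAt.div (by fun_prop)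
      (by linarith [hτ.1])).continuousWithinAt
  have gronwall := add_integral_le_mul_exp ht.1 hκ
    (fun τ hτ => (energy_deriv hτ).continuousAt.continuousWithinAt)
    (fun τ hτ => (energy_deriv (Ico_subset_Icc_self hτ)).hasDerivWithinAt) avg_continuous
    (fun τ hτ => div_nonneg (avg_nonneg τ) (by linarith [hτ.1]))
    (fun τ hτ => deriv_energy_le hρs hκ hF hG ⟨hτ.1, hτ.2.trans ht.2⟩ (hle τ))
  have energy_nonneg : 0 ≤ energy ρs F G t :=
    (re_avg_nonneg ρs t hF).trans (re_avg_le_energy ρs F hG ht)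
  have energy_zero : energy ρs F G 0 = (avg ρs 0 (F + G)).re := by simp [energy]
  calc bulk ρs t (F + G)
      ≤ (avg ρs 0 (F + G)).re * Real.exp (κ * (t - 0)) := by
        rw [bulk_eq hρs ht, ← energy_zero]
        linarith
    _ ≤ (avg ρs 0 (F + G)).re * Real.exp κ := by
        gcongr
        · exact avg_nonneg 0
        · exact mul_le_of_le_one_right hκ (by linarith [ht.2])
    _ = _ := mul_comm _ _

end Energy

section Estimate

variable {ρs t a b κ : ℝ} {F G : SF} {m p : ℕ}

theorem re_eval_wordForm_star_nonneg (n : ℕ) (F : SF) (x : dom) :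
    0 ≤ (eval x (wordForm ζ n F (star F))).re := by
  simp only [wordForm_eq_sum, wordEnd_star, map_sum, map_mul, eval_star, Complex.re_sum]
  refine Finset.sum_nonneg fun w _ => ?_
  rw [Complex.star_def, Complex.mul_conj, Complex.ofReal_re]
  exact Complex.normSq_nonneg _

theorem avg_transL_add_transM_wordForm (h : IsPair transL transM χplus χminus (a : ℂ) b F G)
    (ρs τ : ℝ) (n : ℕ) :
    avg ρs τ (transL (wordForm ζ n F (star F)) + transM (wordForm ζ n G (star G))) =
      -(2 * a * avg ρs τ (wordForm ζ n F (star F)) +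
        2 * b * avg ρs τ (wordForm ζ n G (star G))) := by
  have h_star : IsPair transL transM χminus χplus (a : ℂ) b (star F) (star G) := by
    simpa only [Complex.star_def, Complex.conj_ofReal] using
      h.star transL_star transM_star χplus_star χminus_star
  rw [h.map_wordForm_add h_star transL_mem_skewDerivations transM_mem_skewDerivations
    χplus_mem_skewDerivations χminus_mem_skewDerivations]
  simp only [map_sub, map_neg, map_add, map_smul, smul_eq_mul, avg_χplus, avg_χminus, add_zero,
    neg_zero, zero_sub]

theorem re_avg_wordForm_le (h : IsPair transL transM χplus χminus (a : ℂ) b F G)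
    (ha : 1 - 2 * a ≤ κ) (hb : 1 ≤ 2 * b) (ρs τ : ℝ) (n : ℕ) :
    (avg ρs τ (transL (wordForm ζ n F (star F)) + transM (wordForm ζ n G (star G)) +
        (wordForm ζ n F (star F) + wordForm ζ n G (star G)))).re ≤
      κ * (avg ρs τ (wordForm ζ n F (star F))).re := by
  have avgF_nonneg := re_avg_nonneg ρs τ (re_eval_wordForm_star_nonneg n F)
  have avgG_nonneg := re_avg_nonneg ρs τ (re_eval_wordForm_star_nonneg n G)
  rw [map_add, avg_transL_add_transM_wordForm h, map_add]
  have re_two_mul (r : ℝ) (z : ℂ) : (2 * (r : ℂ) * z).re = 2 * r * z.re := by simp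
  simp only [Complex.add_re, Complex.neg_re, re_two_mul]
  linarith [mul_le_mul_of_nonneg_right ha avgF_nonneg, mul_le_mul_of_nonneg_right hb avgG_nonneg]

/-- `∑ |∂_τ^q ∂_ρ^r Z_w F|²` over all words `w` with `q + r + |w| ≤ m`. -/
abbrev wordDensity (m : ℕ) (F : SF) : SF := sqSum (wordIndices m) wordOp F

/-- `∑ |D^{q,r,α} F|²` over `q + r + |α| ≤ m`, with `c = 1`. -/
abbrev symDensity (m : ℕ) (F : SF) : SF := sqSum (indices m) symOp F

theorem re_eval_sqSum_nonneg {κ : Type*} (t : Finset κ) (B : κ → Module.End ℂ SF) (F : SF)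
    (x : dom) : 0 ≤ (eval x (sqSum t B F)).re := by
  rw [eval_sqSum, Complex.ofReal_re]
  positivity

theorem re_avg_wordDensity_le (h : IsPair transL transM χplus χminus (a : ℂ) b F G)
    (ha : 1 - 2 * (a - m) ≤ κ) (hb : 1 ≤ 2 * (b - m)) (ρs τ : ℝ) :
    (avg ρs τ (transL (wordDensity m F) + transM (wordDensity m G) +
        (wordDensity m F + wordDensity m G))).re ≤ κ * (avg ρs τ (wordDensity m F)).re := by
  simp only [wordDensity, sqSum_wordOp, map_sum, ← Finset.sum_add_distrib, Complex.re_sum,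
    Finset.mul_sum]
  refine Finset.sum_le_sum fun ⟨q, r, n⟩ hx => ?_
  have order_le : (q + r + n : ℝ) ≤ m := by exact_mod_cast mem_orders.1 hx
  have q_nonneg : (0 : ℝ) ≤ q := q.cast_nonneg
  have r_nonneg : (0 : ℝ) ≤ r := r.cast_nonneg
  have n_nonneg : (0 : ℝ) ≤ n := n.cast_nonneg
  have pair : IsPair transL transM χplus χminus ((a + q - r : ℝ) : ℂ) (b - q + r : ℝ)
      (mixed q r F) (mixed q r G) := by
    push_cast
    exact isPair_mixed h q r
  exact re_avg_wordForm_le pair (by linarith [q_nonneg, n_nonneg])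
    (by linarith [r_nonneg, n_nonneg]) ρs τ n

theorem bulk_wordDensity_add_le (hp : m + 2 < p) (hρs : 0 ≤ ρs) (ht : t ∈ Ico (0 : ℝ) 1)
    {k : ℕ} (hk : k ≤ 3) (h : IsPair transL transM χplus χminus (2 - k) (1 - k) F G) :
    bulk ρs t (wordDensity m (δρ^[p] F) + wordDensity m (δρ^[p] G)) ≤
      Real.exp (2 * (m + p) + 3) *
        (avg ρs 0 (wordDensity m (δρ^[p] F) + wordDensity m (δρ^[p] G))).re := by
  have pair : IsPair transL transM χplus χminus ((2 - k - p : ℝ) : ℂ) (1 - k + p : ℝ)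
      (δρ^[p] F) (δρ^[p] G) := by
    simpa [mixed_apply] using isPair_mixed h 0 p
  have hp : (m + 3 : ℝ) ≤ p := by exact_mod_cast hp
  have hk : (k : ℝ) ≤ 3 := by exact_mod_cast hk
  exact bulk_add_le hρs (by positivity) (re_eval_sqSum_nonneg _ _ _) (re_eval_sqSum_nonneg _ _ _)
    (re_avg_wordDensity_le pair (by linarith) (by linarith) ρs) ht

theorem IsSpin2Solution.bulk_wordDensity_le {φ : Fin 5 → Fld} (hφ : IsSpin2Solution φ)
    {Φ : Fin 5 → SF} (hΦ : ∀ k, Agree (φ k) (Φ k)) (hp : m + 2 < p) (hρs : 0 ≤ ρs)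
    (ht : t ∈ Ico (0 : ℝ) 1) (k : Fin 5) :
    bulk ρs t (wordDensity m (δρ^[p] (Φ k))) ≤
      Real.exp (2 * (m + p) + 3) * ∑ j, (avg ρs 0 (wordDensity m (δρ^[p] (Φ j)))).re := by
  set W : Fin 5 → SF := fun j => wordDensity m (δρ^[p] (Φ j))
  have W_nonneg (j : Fin 5) (x : dom) : 0 ≤ (eval x (W j)).re := re_eval_sqSum_nonneg _ _ _ x
  have pair_bound (i : Fin 4) : bulk ρs t (W i.castSucc + W i.succ) ≤
      Real.exp (2 * (m + p) + 3) * ∑ j, (avg ρs 0 (W j)).re := by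
    refine (bulk_wordDensity_add_le hp hρs ht (by lia) (hφ.isPair hΦ i)).trans ?_
    gcongr
    rw [map_add, Complex.add_re]
    exact Finset.add_le_sum (fun j _ => re_avg_nonneg ρs 0 (W_nonneg j)) (Finset.mem_univ _)
      (Finset.mem_univ _) i.castSucc_lt_succ.ne
  have bulk_le_add (i j : Fin 5) :
      bulk ρs t (W i) ≤ bulk ρs t (W i + W j) ∧ bulk ρs t (W j) ≤ bulk ρs t (W i + W j) := by
    constructor <;> rw [← one_mul (bulk ρs t (W i + W j))] <;>
      refine bulk_le_mul ρs ht.2 fun x => ?_ <;> rw [map_add, Complex.add_re] <;>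
      linarith [W_nonneg i x, W_nonneg j x]
  refine Fin.lastCases ?_ (fun i => ?_) k
  · exact (bulk_le_add _ _).2.trans (pair_bound 3)
  · exact (bulk_le_add _ _).1.trans (pair_bound i)

theorem exists_bulk_symDensity_le (hp : m + 2 < p) :
    ∃ C : ℝ, 0 < C ∧ ∀ {φ : Fin 5 → Fld}, IsSpin2Solution φ → ∀ {Φ : Fin 5 → SF},
      (∀ k, Agree (φ k) (Φ k)) → ∀ {ρs : ℝ}, 0 ≤ ρs → ∀ t ∈ Ico (0 : ℝ) 1, ∀ k,
        bulk ρs t (symDensity m (δρ^[p] (Φ k))) ≤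
          C * ∑ j, (avg ρs 0 (symDensity m (δρ^[p] (Φ j)))).re := by
  obtain ⟨A, hA, sym_le_word⟩ := exists_sqSum_le fun _ => symOp_mem_span_wordOp (m := m)
  obtain ⟨B, hB, word_le_sym⟩ := exists_sqSum_le fun _ => wordOp_mem_span_symOp (m := m)
  refine ⟨A * (Real.exp (2 * (m + p) + 3) * B) + 1, by positivity, fun hφ Φ hΦ ρs hρs t ht k => ?_⟩
  have sum_nonneg : 0 ≤ ∑ j, (avg ρs 0 (symDensity m (δρ^[p] (Φ j)))).re :=
    Finset.sum_nonneg fun j _ => re_avg_nonneg ρs 0 (re_eval_sqSum_nonneg _ _ _)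
  calc bulk ρs t (symDensity m (δρ^[p] (Φ k)))
      ≤ A * bulk ρs t (wordDensity m (δρ^[p] (Φ k))) := bulk_le_mul ρs ht.2 (sym_le_word _)
    _ ≤ A * (Real.exp (2 * (m + p) + 3) *
          ∑ j, (avg ρs 0 (wordDensity m (δρ^[p] (Φ j)))).re) := by
        gcongr
        exact hφ.bulk_wordDensity_le hΦ hp hρs ht k
    _ ≤ A * (Real.exp (2 * (m + p) + 3) *
          ∑ j, B * (avg ρs 0 (symDensity m (δρ^[p] (Φ j)))).re) := by
        gcongr
        exact re_avg_le_mul ρs 0 (word_le_sym _)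
    _ ≤ _ := by
        rw [← Finset.mul_sum]
        linarith

end Estimate

section Density

variable {f : Fld} {F : SF} {t : ℝ}

theorem Agree.density_eq_extend (h : Agree f F) (c : ℝ) (m : ℕ) {x : ℝ × ℝ × SU2} (hx : x ∈ dom) :
    density c m f x.1 x.2.1 x.2.2 = c ^ 2 * (extend (symDensity m F) x).re := by
  rw [extend_of_mem _ hx]
  exact h.density_eq c m ⟨x, hx⟩

theorem Agree.continuousOn_density (h : Agree f F) (c : ℝ) (m : ℕ) :
    ContinuousOn (fun x : ℝ × ℝ × SU2 => density c m f x.1 x.2.1 x.2.2) dom :=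
  (continuousOn_const.mul (continuousOn_re_extend _)).congr fun _ hx => h.density_eq_extend c m hx

theorem Agree.integral_N_density (h : Agree f F) (c : ℝ) (m : ℕ) (ρs : ℝ) (ht : t < 1) :
    ∫ x in N ρs t, density c m f x.1 x.2.1 x.2.2 ∂(volume.prod (volume.prod haarSU2)) =
      c ^ 2 * bulk ρs t (symDensity m F) := by
  rw [bulk, ← integral_const_mul]
  exact setIntegral_congr_fun (measurableSet_N ρs t) fun x hx =>
    h.density_eq_extend c m (N_subset_dom ρs ht hx)

theorem Agree.integrableOn_S_zero_density (h : Agree f F) (c : ℝ) (m : ℕ) (ρs : ℝ) :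
    IntegrableOn (fun y : ℝ × SU2 => density c m f 0 y.1 y.2) (S ρs 0) (volume.prod haarSU2) := by
  rw [S_zero]
  exact integrableOn_slab (h.continuousOn_density c m) (by simp) ρs

theorem Agree.integral_S_zero_density (h : Agree f F) (c : ℝ) (m : ℕ) (ρs : ℝ) :
    ∫ y in S ρs 0, density c m f 0 y.1 y.2 ∂(volume.prod haarSU2) =
      c ^ 2 * (avg ρs 0 (symDensity m F)).re := by
  rw [S_zero, re_avg, ← integral_const_mul]
  refine setIntegral_congr_fun (measurableSet_slab ρs) fun y hy => ?_
  have mem_dom : (0, y) ∈ dom := prod_slab_subset_dom ρs ⟨by simp, hy⟩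
  have comoving_zero : comoving (0, y) = (0, y) := by
    rw [comoving, add_zero, div_one]
  rw [comoving_zero]
  exact h.density_eq_extend c m mem_dom

end Density

end Spin2

end

open Spin2

theorem mainTheorem2 (m p : ℕ) (hp : m + 2 < p) :
    ∃ C : ℝ, 0 < C ∧ ∀ (c : ℝ), 0 < c → ∀ (ρs : ℝ), 0 < ρs →
      ∀ φ : Fin 5 → Spin2.Fld, Spin2.IsSpin2Solution φ →
        (∀ k : Fin 5, IntegrableOn
          (fun y : ℝ × Spin2.SU2 => Spin2.density c m (Spin2.dρ^[p] (φ k)) 0 y.1 y.2)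
          (Spin2.S ρs 0) (volume.prod Spin2.haarSU2)) ∧
        (∀ t ∈ Ico (0 : ℝ) 1, ∀ k : Fin 5,
          IntegrableOn
            (fun x : ℝ × ℝ × Spin2.SU2 =>
              Spin2.density c m (Spin2.dρ^[p] (φ k)) x.1 x.2.1 x.2.2)
            (Spin2.N ρs t) (volume.prod (volume.prod Spin2.haarSU2)) ∧
          ∫ x in Spin2.N ρs t, Spin2.density c m (Spin2.dρ^[p] (φ k)) x.1 x.2.1 x.2.2
              ∂(volume.prod (volume.prod Spin2.haarSU2)) ≤
            C * ∑ j : Fin 5, ∫ y in Spin2.S ρs 0,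
              Spin2.density c m (Spin2.dρ^[p] (φ j)) 0 y.1 y.2
                ∂(volume.prod Spin2.haarSU2)) ∧
        (∀ k : Fin 5, BddAbove ((fun t : ℝ =>
          ∫ x in Spin2.N ρs t, Spin2.density c m (Spin2.dρ^[p] (φ k)) x.1 x.2.1 x.2.2
            ∂(volume.prod (volume.prod Spin2.haarSU2))) '' Ico (0 : ℝ) 1)) := by
  obtain ⟨C, C_pos, bulk_le⟩ := exists_bulk_symDensity_le hp
  refine ⟨C, C_pos, fun c _ ρs hρs φ hφ => ?_⟩
  choose Φ hΦ using fun k => (hφ.smooth k).exists_agree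
  have agree (k : Fin 5) := (hΦ k).iterate_dρ p
  have estimate (t : ℝ) (ht : t ∈ Ico (0 : ℝ) 1) (k : Fin 5) :
      ∫ x in N ρs t, density c m (dρ^[p] (φ k)) x.1 x.2.1 x.2.2
          ∂(volume.prod (volume.prod haarSU2)) ≤
        C * ∑ j, ∫ y in S ρs 0, density c m (dρ^[p] (φ j)) 0 y.1 y.2 ∂(volume.prod haarSU2) := by
    simp only [(agree _).integral_N_density c m ρs ht.2, (agree _).integral_S_zero_density,
      ← Finset.mul_sum]
    rw [mul_left_comm]
    exact mul_le_mul_of_nonneg_left (bulk_le hφ hΦ hρs.le t ht k) (sq_nonneg c)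
  exact ⟨fun k => (agree k).integrableOn_S_zero_density c m ρs,
    fun t ht k => ⟨integrableOn_N ((agree k).continuousOn_density c m) ρs ht.2, estimate t ht k⟩,
    fun k => ⟨_, forall_mem_image.2 fun t ht => estimate t ht k⟩⟩
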